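/- Fix a dimension $d$ and let $\mathbf{T}^d=\mathbb{R}^d/\mathbb{Z}^d$ with the norm $\|x\|=\max_i|x_i|$ ($|x_i|$ being the distance from $x_i$ to the nearest integer) and Lebesgue measure. Let $F_{\rm in},F_{\rm out}:\mathbf{T}^d\to[0,1]$ be measurable functions such that $F_{\rm in}(x)$ and $F_{\rm out}(x)$ depend only on $\|x\|$. For $k\in\mathbb{Z}^d$ write $\widehat F(k)=\int_{\mathbf{T}^d}F(x)e^{-2i\pi\langle k,x\rangle}\,dx$, and put $\mu_{\rm in}=\widehat F_{\rm in}(0)$, $\mu_{\rm out}=\widehat F_{\rm out}(0)$. For even $n$, the two-block Soft Geometric Block Model $\mathrm{SGBM}(n)$ is the following random graph on $\{1,\dots,n\}$. The labelling $\sigma\in\{1,2\}^n$ is uniform among those with exactly $n/2$ labels equal to $1$ and $n/2$ labels equal to $2$; the positions $X_1,\dots,X_n$ are independent and uniform on $\mathbf{T}^d$, independent of $\sigma$; and, conditionally on $(\sigma,X)$, the edges $\{i,j\}$, $i<j$, are present independently, with probability $F_{\rm in}(X_i-X_j)$ if $\sigma_i=\sigma_j$ and $F_{\rm out}(X_i-X_j)$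 otherwise. Let $A=A_n$ be its adjacency matrix. Assume that $\mu_{\rm in}\neq\mu_{\rm out}$ and $$\widehat F_{\rm in}(k)+\widehat F_{\rm out}(k)\neq\mu_{\rm in}-\mu_{\rm out}\quad\text{for all }k\in\mathbb{Z}^d,\qquad \widehat F_{\rm in}(k)-\widehat F_{\rm out}(k)\neq\mu_{\rm in}-\mu_{\rm out}\quad\text{for all }k\in\mathbb{Z}^d\setminus\{0\}.$$ Then there is a deterministic $\epsilon>0$, depending only on $d$, $F_{\rm in}$ and $F_{\rm out}$, such that whenever graphs distributed as $\mathrm{SGBM}(n)$, for all even $n$, are defined on one probability space (with any joint distribution), the following holds almost surely for all sufficiently large even $n$. There is a unique eigenvalue $\widetilde\lambda$ of $A_n$ closest to $\lambda_*=n(\mu_{\rm in}-\mu_{\rm out})/2$, it has multiplicity one, and every other eigenvalue $\lambda$ of $A_n$ satisfies $|\lambda-\widetilde\lambda|\ge\epsilon n$ and $|\lambda-\lambda_*|\ge\epsilon n$. -/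

import Mathlib

open MeasureTheory ProbabilityTheory Filter

noncomputable section

/-- A connectivity probability function on the flat torus `ℝ^d / ℤ^d`: measurable, with values
in `[0,1]`, and depending only on the norm `‖x‖ = max_i |x_i|`, where `|x_i|` is the distance
from `x_i` to the nearest integer (the norm that Mathlib puts on `UnitAddTorus (Fin d)`). -/
structure IsConnectivityFunction {d : ℕ} (F : UnitAddTorus (Fin d) → ℝ) : Prop where
  measurable : Measurable F
  nonneg : ∀ x, 0 ≤ F x
  le_one : ∀ x, F x ≤ 1
  radial : ∀ x y, ‖x‖ = ‖y‖ → F x = F y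

/-- Fourier coefficient `∫ F(x) exp(-2πi⟨k,x⟩) dx` of a real function on the torus. -/
def torusFourier {d : ℕ} (F : UnitAddTorus (Fin d) → ℝ) (k : Fin d → ℤ) : ℂ :=
  ∫ x, UnitAddTorus.mFourier (-k) x * (F x : ℂ)

/-- Average edge density `∫ F(x) dx`. -/
def edgeDensity {d : ℕ} (F : UnitAddTorus (Fin d) → ℝ) : ℝ := ∫ x, F x

/-- The homogeneous connectivity function `F(x, s, s')` of the two-block model. -/
def connectivity {d : ℕ} (F_in F_out : UnitAddTorus (Fin d) → ℝ)
    (x : UnitAddTorus (Fin d)) (s s' : Fin 2) : ℝ :=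
  if s = s' then F_in x else F_out x

/-- Labellings of `n` nodes by two labels, with both blocks of size exactly `n / 2`. -/
def balancedLabellings (n : ℕ) : Set (Fin n → Fin 2) :=
  {σ | ∀ s : Fin 2, 2 * (Finset.univ.filter (fun i => σ i = s)).card = n}

open Classical in
/-- The probability of the graph `G` given the labels `σ` and the positions `X`: the edges
`{i, j}`, `i < j`, are independent, present with probability `F(X_i - X_j, σ_i, σ_j)`. -/
def graphProbability {d n : ℕ} (F_in F_out : UnitAddTorus (Fin d) → ℝ)
    (σ : Fin n → Fin 2) (X : Fin n → UnitAddTorus (Fin d)) (G : SimpleGraph (Fin n)) : ℝ :=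
  ∏ i : Fin n, ∏ j ∈ Finset.Ioi i,
    if G.Adj i j then connectivity F_in F_out (X i - X j) (σ i) (σ j)
    else 1 - connectivity F_in F_out (X i - X j) (σ i) (σ j)

/-- The joint law of (labels, positions, graph) in the Soft Geometric Block Model with two blocks
of size `n / 2`: the labelling is uniform over the balanced ones, the positions are independent
and uniform on the torus, independent of the labels, and, conditionally on labels and positions,
the graph `G` has probability `graphProbability σ X G`. Equivalently, `graphProbability` is the
density of the joint law with respect to (law of labels) × (law of positions) × (counting). -/
def sgbmLaw {d : ℕ} (n : ℕ) (F_in F_out : UnitAddTorus (Fin d) → ℝ) :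
    Measure ((Fin n → Fin 2) × (Fin n → UnitAddTorus (Fin d)) × SimpleGraph (Fin n)) :=
  ((uniformOn (balancedLabellings n)).prod
    ((volume : Measure (Fin n → UnitAddTorus (Fin d))).prod
      (Measure.count : Measure (SimpleGraph (Fin n))))).withDensity
    (fun z => ENNReal.ofReal (graphProbability F_in F_out z.1 z.2.1 z.2.2))

/-- The value `n (μ_in - μ_out) / 2`. -/
def idealValue {d : ℕ} (n : ℕ) (F_in F_out : UnitAddTorus (Fin d) → ℝ) : ℝ :=
  n * (edgeDensity F_in - edgeDensity F_out) / 2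

open Classical in
/-- The real `0/1` adjacency matrix of a graph. -/
def adjacencyMatrix {n : ℕ} (G : SimpleGraph (Fin n)) : Matrix (Fin n) (Fin n) ℝ :=
  G.adjMatrix ℝ

/-- `t` is a (real) eigenvalue of the matrix `A`. -/
def IsEigenvalue {n : ℕ} (A : Matrix (Fin n) (Fin n) ℝ) (t : ℝ) : Prop :=
  Module.End.HasEigenvalue (Matrix.toLin' A) t

/-- The multiplicity of `t` as an eigenvalue of the symmetric matrix `A`: the dimension of its
eigenspace. -/
def eigenvalueMultiplicity {n : ℕ} (A : Matrix (Fin n) (Fin n) ℝ) (t : ℝ) : ℕ :=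
  Module.finrank ℝ (Module.End.eigenspace (Matrix.toLin' A) t)

end

/-! Write θ₀ = (μ_in − μ_out)/2, so that λ_* = nθ₀. Take the modes φ_κ: a character of the torus
times a character of the label set (constant, or sign of the block). Given the position of node i,
row i of A applied to φ_κ is a sum of independent bounded terms with mean nθ_κ φ_κ(i) up to a
bounded error, where θ_κ = (F̂_in(k) ± F̂_out(k))/2. So every mode is an approximate eigenvector.
The sign vector χ of the labelling is the mode with value nθ₀, which gives an eigenvalue near λ_*;
the hypotheses say that θ₀ ≠ 0 and that θ_κ ≠ θ₀ for every other mode.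

The difficulty is that no other eigenvalue comes close, since the 0/1 matrix A is not entrywise
close to a kernel of finite rank. Its square is, off the diagonal: (A²)_ij counts common neighbours,
hence concentrates around n times a convolution, and a convolution of bounded functions is uniformly
close to a trigonometric polynomial, that is, to a combination of finitely many modes
(`norm_integral_sub_mul_sub_le`). If two eigenvalues lay within εn of λ_*, some unit combination w
of their eigenvectors would be orthogonal to χ. By symmetry of A it would also be nearly orthogonal
to the other modes, whose values are separated from θ₀. Then A²w would be small, although both
eigenvalues exceed |θ₀|n/2 in absolute value. This is `exists_isolated_eigenvalue`.

The probabilistic input is a conditional Hoeffding inequality, `measure_pi_norm_sum_ge_le_of_fixed`.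
The graph is built from uniform variables, the one deciding an edge being stored at one of its
endpoints. The law does not depend on which endpoint (`lintegral_graphProbability_eq`), so for each
row or entry the storage is chosen to make the summands independent given one or two fixed nodes. A
union bound over O(n²) events and the Borel–Cantelli lemma conclude. -/

/-! ### Spectral facts about real symmetric matrices. -/

namespace Matrix.IsHermitian

variable {n : ℕ} {A : Matrix (Fin n) (Fin n) ℝ}

/-- Real coordinate of a vector along the `i`-th vector of the orthonormal eigenbasis. -/
lemma sum_eigenvectorBasis_mulVec (hA : A.IsHermitian) (v : Fin n → ℝ) (i : Fin n) :
    ∑ j, hA.eigenvectorBasis i j * (A.mulVec v) j =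
      hA.eigenvalues i * ∑ j, hA.eigenvectorBasis i j * v j := by
  have h := hA.mulVec_eigenvectorBasis i
  have hsymm : A.transpose = A := by simpa using hA.eq
  calc ∑ j, hA.eigenvectorBasis i j * (A.mulVec v) j
      = dotProduct (hA.eigenvectorBasis i).ofLp (A.mulVec v) := rfl
    _ = dotProduct (A.mulVec (hA.eigenvectorBasis i).ofLp) v := by
        rw [Matrix.dotProduct_mulVec, ← Matrix.mulVec_transpose, hsymm]
    _ = _ := by rw [h, smul_dotProduct]; rfl

lemma sum_sq_eigenvectorBasis (hA : A.IsHermitian) (v : Fin n → ℝ) :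
    ∑ i, (∑ j, hA.eigenvectorBasis i j * v j) ^ 2 = ∑ j, v j ^ 2 := by
  have h := hA.eigenvectorBasis.sum_sq_norm_inner_right (WithLp.toLp 2 v)
  rw [EuclideanSpace.real_norm_sq_eq] at h
  rw [← h]
  refine Finset.sum_congr rfl fun i _ => ?_
  rw [Real.norm_eq_abs, sq_abs]
  congr 1
  simp [PiLp.inner_apply, mul_comm]

lemma sum_eigenvectorBasis_mul (hA : A.IsHermitian) (i i' : Fin n) :
    ∑ j, hA.eigenvectorBasis i j * hA.eigenvectorBasis i' j = if i = i' then 1 else 0 := by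
  have h := orthonormal_iff_ite.1 hA.eigenvectorBasis.orthonormal i i'
  rw [← h]
  simp [PiLp.inner_apply, mul_comm]

/-- A symmetric matrix has an eigenvalue near every approximate eigenvalue. -/
lemma exists_eigenvalue_near (hA : A.IsHermitian) {v : Fin n → ℝ} {μ δ : ℝ} (hδ : 0 ≤ δ)
    (hv : 0 < ∑ j, v j ^ 2)
    (h : ∑ j, (A.mulVec v j - μ * v j) ^ 2 ≤ δ ^ 2 * ∑ j, v j ^ 2) :
    ∃ i, |hA.eigenvalues i - μ| ≤ δ := by
  by_contra! hfar
  rw [← hA.sum_sq_eigenvectorBasis v] at h hv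
  rw [← hA.sum_sq_eigenvectorBasis (fun j => A.mulVec v j - μ * v j)] at h
  have hcoord : ∀ i, ∑ j, hA.eigenvectorBasis i j * (A.mulVec v j - μ * v j) =
      (hA.eigenvalues i - μ) * ∑ j, hA.eigenvectorBasis i j * v j := by
    intro i
    rw [sub_mul, ← hA.sum_eigenvectorBasis_mulVec, Finset.mul_sum, ← Finset.sum_sub_distrib]
    exact Finset.sum_congr rfl fun j _ => by ring
  simp_rw [hcoord, mul_pow] at h
  rw [Finset.mul_sum] at h
  have hsq : ∀ i, δ ^ 2 < (hA.eigenvalues i - μ) ^ 2 := fun i => by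
    rw [← sq_abs (hA.eigenvalues i - μ)]
    exact pow_lt_pow_left₀ (hfar i) hδ two_ne_zero
  -- A nonzero coordinate of `v` makes the comparison strict, including when `δ = 0`.
  obtain ⟨i, -, hi⟩ := Finset.exists_lt_of_sum_lt (f := fun _ => (0 : ℝ)) (by simpa using hv)
  refine absurd h (not_le.2 (Finset.sum_lt_sum (fun i _ => ?_) ⟨i, Finset.mem_univ _, ?_⟩))
  · exact mul_le_mul_of_nonneg_right (hsq i).le (sq_nonneg _)
  · exact mul_lt_mul_of_pos_right (hsq i) hi

lemma isEigenvalue_iff (hA : A.IsHermitian) {s : ℝ} :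
    IsEigenvalue A s ↔ ∃ i, s = hA.eigenvalues i := by
  constructor
  · intro hs
    obtain ⟨v, hv⟩ := hs.exists_hasEigenvector
    have hAv : A.mulVec v = s • v := by simpa using hv.apply_eq_smul
    have hpos : 0 < ∑ j, v j ^ 2 := by
      obtain ⟨j, hj⟩ := Function.ne_iff.1 hv.2
      exact Finset.sum_pos' (fun _ _ => sq_nonneg _) ⟨j, Finset.mem_univ _, sq_pos_iff.2 (by simpa using hj)⟩
    -- An exact eigenvector has error `δ = 0`, so the nearby eigenvalue is `s` itself.
    obtain ⟨i, hi⟩ := hA.exists_eigenvalue_near (μ := s) le_rfl hpos (by simp [hAv])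
    exact ⟨i, by linarith [abs_nonpos_iff.1 hi]⟩
  · rintro ⟨i, rfl⟩
    refine Module.End.hasEigenvalue_of_hasEigenvector (x := (hA.eigenvectorBasis i).ofLp)
      ⟨Module.End.mem_eigenspace_iff.2 (by simpa using hA.mulVec_eigenvectorBasis i), ?_⟩
    intro h0
    exact hA.eigenvectorBasis.toBasis.ne_zero i (by
      simpa using congrArg (WithLp.toLp 2) h0)

/-- Along any other basis vector, the coordinate of an eigenvector is killed by the nonzero
difference of eigenvalues, so the eigenspace is the line of the `i`-th vector. -/
lemma eigenvalueMultiplicity_eq_one (hA : A.IsHermitian) {i : Fin n}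
    (hi : ∀ i', i' ≠ i → hA.eigenvalues i' ≠ hA.eigenvalues i) :
    eigenvalueMultiplicity A (hA.eigenvalues i) = 1 := by
  have hmem : (hA.eigenvectorBasis i).ofLp ∈
      Module.End.eigenspace (Matrix.toLin' A) (hA.eigenvalues i) :=
    Module.End.mem_eigenspace_iff.2 (by simpa using hA.mulVec_eigenvectorBasis i)
  refine finrank_eq_one_iff'.2 ⟨⟨_, hmem⟩, ?_, ?_⟩
  · intro h0
    exact hA.eigenvectorBasis.toBasis.ne_zero i (by
      simpa using congrArg (WithLp.toLp 2) (congrArg Subtype.val h0))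
  · rintro ⟨v, hv⟩
    have hAv : A.mulVec v = hA.eigenvalues i • v := by
      simpa using Module.End.mem_eigenspace_iff.1 hv
    refine ⟨∑ j, hA.eigenvectorBasis i j * v j, Subtype.ext ?_⟩
    have hcoord : ∀ i', i' ≠ i → ∑ j, hA.eigenvectorBasis i' j * v j = 0 := by
      intro i' hne
      have h := hA.sum_eigenvectorBasis_mulVec v i'
      simp only [hAv, Pi.smul_apply, smul_eq_mul, mul_left_comm _ (hA.eigenvalues i)] at h
      rw [← Finset.mul_sum] at h
      exact (mul_eq_zero.1 (show (hA.eigenvalues i' - hA.eigenvalues i) * _ = 0 by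
        rw [sub_mul, ← h, sub_self])).resolve_left (sub_ne_zero.2 (hi i' hne))
    have hsum := hA.eigenvectorBasis.sum_repr (WithLp.toLp 2 v)
    rw [Finset.sum_eq_single i] at hsum
    · have := congrArg WithLp.ofLp hsum
      simpa [OrthonormalBasis.repr_apply_apply, PiLp.inner_apply, mul_comm] using this
    · intro i' _ hne
      rw [OrthonormalBasis.repr_apply_apply]
      have : inner ℝ (hA.eigenvectorBasis i') (WithLp.toLp 2 v) = (0 : ℝ) := by
        rw [← hcoord i' hne]; simp [PiLp.inner_apply, mul_comm]
      rw [this, zero_smul]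
    · simp

/-- Two eigenvectors with eigenvalues near `μ` have a combination orthogonal to a given vector. -/
lemma exists_orthogonal_combination (hA : A.IsHermitian) {i i' : Fin n} (hne : i ≠ i')
    {μ r : ℝ} (hrμ : r ≤ |μ|) (hi : |hA.eigenvalues i - μ| ≤ r)
    (hi' : |hA.eigenvalues i' - μ| ≤ r) (χ : Fin n → ℝ) :
    ∃ w : Fin n → ℝ, ∑ j, w j ^ 2 = 1 ∧ ∑ j, χ j * w j = 0 ∧
      ∑ j, (A.mulVec w j - μ * w j) ^ 2 ≤ r ^ 2 ∧
      (|μ| - r) ^ 4 ≤ ∑ j, (A.mulVec (A.mulVec w) j) ^ 2 := by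
  have hr : 0 ≤ r := (abs_nonneg _).trans hi
  obtain ⟨α, β, hαβ, hχ⟩ : ∃ α β : ℝ, α ^ 2 + β ^ 2 = 1 ∧
      α * ∑ j, χ j * hA.eigenvectorBasis i j + β * ∑ j, χ j * hA.eigenvectorBasis i' j = 0 := by
    generalize ∑ j, χ j * hA.eigenvectorBasis i j = p
    generalize ∑ j, χ j * hA.eigenvectorBasis i' j = q
    -- If both inner products with `χ` vanish, any unit pair will do; otherwise the normalised `(q,
    -- -p)` cancels them.
    by_cases hpq : p ^ 2 + q ^ 2 = 0
    · have hp : p = 0 := by nlinarith [sq_nonneg p, sq_nonneg q]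
      exact ⟨1, 0, by norm_num, by simp [hp]⟩
    · have hpos : 0 < p ^ 2 + q ^ 2 := lt_of_le_of_ne (by positivity) (Ne.symm hpq)
      have hs := Real.sq_sqrt hpos.le
      have hs0 := Real.sqrt_pos.2 hpos
      refine ⟨q / √(p ^ 2 + q ^ 2), -p / √(p ^ 2 + q ^ 2), ?_, by ring⟩
      rw [div_pow, div_pow, hs, neg_sq, ← add_div, add_comm, div_self hpq]
  set b := fun i j => hA.eigenvectorBasis i j with hb
  have hAb : ∀ i, A.mulVec (b i) = hA.eigenvalues i • b i := hA.mulVec_eigenvectorBasis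
  have hcomb : ∀ x y : ℝ, ∑ j, (x * b i j + y * b i' j) ^ 2 = x ^ 2 + y ^ 2 := by
    intro x y
    have h1 := hA.sum_eigenvectorBasis_mul i i
    have h2 := hA.sum_eigenvectorBasis_mul i i'
    have h3 := hA.sum_eigenvectorBasis_mul i' i'
    simp only [if_true, if_neg hne] at h1 h2 h3
    calc _ = x ^ 2 * ∑ j, b i j * b i j + 2 * x * y * ∑ j, b i j * b i' j
          + y ^ 2 * ∑ j, b i' j * b i' j := by
          simp_rw [Finset.mul_sum, ← Finset.sum_add_distrib]
          exact Finset.sum_congr rfl fun j _ => by ring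
      _ = _ := by simp only [hb, h1, h2, h3]; ring
  have hlin : ∀ x y : ℝ, A.mulVec (fun j => x * b i j + y * b i' j) =
      fun j => x * hA.eigenvalues i * b i j + y * hA.eigenvalues i' * b i' j := by
    intro x y
    have : (fun j => x * b i j + y * b i' j) = x • b i + y • b i' := rfl
    rw [this, Matrix.mulVec_add, Matrix.mulVec_smul, Matrix.mulVec_smul, hAb, hAb]
    ext j
    simp [mul_assoc]
  refine ⟨fun j => α * b i j + β * b i' j, ?_, ?_, ?_, ?_⟩
  · rw [hcomb, hαβ]
  · rw [← hχ, Finset.mul_sum, Finset.mul_sum, ← Finset.sum_add_distrib]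
    exact Finset.sum_congr rfl fun j _ => by simp only [hb]; ring
  · rw [hlin]
    have : ∀ j, α * hA.eigenvalues i * b i j + β * hA.eigenvalues i' * b i' j -
        μ * (α * b i j + β * b i' j) =
        (α * (hA.eigenvalues i - μ)) * b i j + (β * (hA.eigenvalues i' - μ)) * b i' j := by
      intro j; ring
    simp_rw [this]
    rw [hcomb, mul_pow, mul_pow]
    have h1 := sq_le_sq' (abs_le.1 hi).1 (abs_le.1 hi).2
    have h2 := sq_le_sq' (abs_le.1 hi').1 (abs_le.1 hi').2
    nlinarith [sq_nonneg α, sq_nonneg β]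
  · rw [hlin, hlin, hcomb]
    have key : ∀ l : ℝ, |l - μ| ≤ r → (|μ| - r) ^ 4 ≤ l ^ 4 := by
      intro l hl
      have : |μ| - r ≤ |l| := by
        have := abs_sub_abs_le_abs_sub μ l
        rw [abs_sub_comm] at this
        linarith
      have := pow_le_pow_left₀ (sub_nonneg.2 hrμ) this 4
      rwa [show |l| ^ 4 = l ^ 4 by rw [← abs_pow, abs_of_nonneg (by positivity)]] at this
    have h1 := mul_le_mul_of_nonneg_left (key _ hi) (sq_nonneg α)
    have h2 := mul_le_mul_of_nonneg_left (key _ hi') (sq_nonneg β)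
    calc (|μ| - r) ^ 4 = α ^ 2 * (|μ| - r) ^ 4 + β ^ 2 * (|μ| - r) ^ 4 := by
          rw [← add_mul, hαβ, one_mul]
      _ ≤ α ^ 2 * hA.eigenvalues i ^ 4 + β ^ 2 * hA.eigenvalues i' ^ 4 := add_le_add h1 h2
      _ = _ := by ring

end Matrix.IsHermitian

/-- Cauchy–Schwarz against the constant vector. -/
lemma sum_abs_le_sqrt_mul {n : ℕ} {w : Fin n → ℝ} {r : ℝ} (hr : 0 ≤ r)
    (hw : ∑ j, w j ^ 2 ≤ r ^ 2) : ∑ j, |w j| ≤ √n * r := by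
  refine abs_le_of_sq_le_sq' ?_ (by positivity) |>.2
  have h := sq_sum_le_card_mul_sum_sq (s := Finset.univ) (f := fun j => |w j|)
  simp only [sq_abs, Finset.card_univ, Fintype.card_fin] at h
  rw [mul_pow, Real.sq_sqrt (by positivity)]
  exact h.trans (mul_le_mul_of_nonneg_left hw (by positivity))

/-! ### A deterministic criterion for a simple isolated eigenvalue. -/

section Deterministic

open ComplexConjugate

variable {n : ℕ} {A : Matrix (Fin n) (Fin n) ℝ} {K : Type*} [Fintype K]
  {φ : K → Fin n → ℂ} {θ c : K → ℂ}

/-- An approximate eigenvector of `A` for one approximate eigenvalue is nearly orthogonal to an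
approximate eigenvector for another one. -/
lemma norm_sum_mul_le_of_approx_eigenvector (hsymm : A.IsHermitian) {w : Fin n → ℝ}
    {ψ : Fin n → ℂ} {ζ : ℂ} {θ₀ δ ε γ : ℝ} (hn : 0 < n) (hγ : 0 < γ) (hε : 0 ≤ ε) (hδ : 0 ≤ δ)
    (hψ : ∀ i, ‖ψ i‖ ≤ 1)
    (hE : ∀ i, ‖∑ j, (A i j : ℂ) * ψ j - n * ζ * ψ i‖ ≤ δ * n)
    (hsep : γ ≤ ‖ζ - θ₀‖) (hw : ∑ j, w j ^ 2 = 1)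
    (happrox : ∑ j, (A.mulVec w j - n * θ₀ * w j) ^ 2 ≤ (ε * n) ^ 2) :
    ‖∑ i, (w i : ℂ) * ψ i‖ ≤ (δ + ε) / γ * √n := by
  have hn' : (0 : ℝ) < n := by exact_mod_cast hn
  have hA : ∀ i j, A i j = A j i := fun i j => by simpa using hsymm.apply j i
  have hswap : ∑ i, (w i : ℂ) * ∑ j, (A i j : ℂ) * ψ j = ∑ i, (A.mulVec w i : ℂ) * ψ i := by
    simp_rw [Matrix.mulVec, dotProduct, Complex.ofReal_sum, Finset.mul_sum, Finset.sum_mul]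
    rw [Finset.sum_comm]
    refine Finset.sum_congr rfl fun i _ => Finset.sum_congr rfl fun j _ => ?_
    rw [hA j i]; push_cast; ring
  -- Pairing `w` with `A ψ` and moving `A` across by symmetry isolates the inner product, multiplied
  -- by the gap, as a difference of two error terms; Cauchy–Schwarz bounds each. No conjugate is
  -- needed because `w` and `A` are real.
  have hident : (n : ℂ) * (ζ - θ₀) * ∑ i, (w i : ℂ) * ψ i =
      ∑ i, ((A.mulVec w i - n * θ₀ * w i : ℝ) : ℂ) * ψ i -
      ∑ i, (w i : ℂ) * (∑ j, (A i j : ℂ) * ψ j - n * ζ * ψ i) := by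
    have e1 : ∑ i, ((A.mulVec w i - n * θ₀ * w i : ℝ) : ℂ) * ψ i =
        ∑ i, (A.mulVec w i : ℂ) * ψ i - n * θ₀ * ∑ i, (w i : ℂ) * ψ i := by
      rw [Finset.mul_sum, ← Finset.sum_sub_distrib]
      exact Finset.sum_congr rfl fun i _ => by push_cast; ring
    have e2 : ∑ i, (w i : ℂ) * (∑ j, (A i j : ℂ) * ψ j - n * ζ * ψ i) =
        ∑ i, (A.mulVec w i : ℂ) * ψ i - n * ζ * ∑ i, (w i : ℂ) * ψ i := by
      rw [← hswap, Finset.mul_sum, ← Finset.sum_sub_distrib]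
      exact Finset.sum_congr rfl fun i _ => by ring
    rw [e1, e2]
    ring
  have h1 : ‖∑ i, ((A.mulVec w i - n * θ₀ * w i : ℝ) : ℂ) * ψ i‖ ≤ √n * (ε * n) := by
    refine (norm_sum_le_of_le _ fun i _ => ?_).trans
      (sum_abs_le_sqrt_mul (by positivity) happrox)
    rw [norm_mul, Complex.norm_real, Real.norm_eq_abs]
    exact mul_le_of_le_one_right (abs_nonneg _) (hψ i)
  have h2 : ‖∑ i, (w i : ℂ) * (∑ j, (A i j : ℂ) * ψ j - n * ζ * ψ i)‖ ≤ √n * 1 * (δ * n) := by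
    refine (norm_sum_le_of_le (f := fun i => (w i : ℂ) * (∑ j, (A i j : ℂ) * ψ j - n * ζ * ψ i))
      (n := fun i => |w i| * (δ * n)) _ fun i _ => ?_).trans ?_
    · rw [norm_mul, Complex.norm_real, Real.norm_eq_abs]
      exact mul_le_mul_of_nonneg_left (hE i) (abs_nonneg _)
    · rw [← Finset.sum_mul]
      exact mul_le_mul_of_nonneg_right (sum_abs_le_sqrt_mul zero_le_one (by simp [hw]))
        (by positivity)
  have h3 : n * ‖ζ - θ₀‖ * ‖∑ i, (w i : ℂ) * ψ i‖ ≤ √n * (ε * n) + √n * 1 * (δ * n) := by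
    have := congrArg norm hident
    rw [norm_mul, norm_mul, Complex.norm_natCast] at this
    rw [this]
    exact (norm_sub_le _ _).trans (add_le_add h1 h2)
  have h4 : γ * ‖∑ i, (w i : ℂ) * ψ i‖ ≤ (δ + ε) * √n := by
    refine (mul_le_mul_of_nonneg_right hsep (norm_nonneg _)).trans ?_
    refine le_of_mul_le_mul_left ?_ hn'
    linarith
  rw [div_mul_eq_mul_div, le_div_iff₀ hγ, mul_comm]
  exact h4

/-- If `A ^ 2` is entrywise close to a low rank matrix built on vectors nearly orthogonal to `w`,
then `A ^ 2 w` is small. -/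
lemma sum_sq_mulVec_mulVec_le (hentry : ∀ i j, |A i j| ≤ 1) (hφ : ∀ κ i, ‖φ κ i‖ ≤ 1)
    {η ρ C : ℝ} (hη : 0 ≤ η) (hρ : 0 ≤ ρ) (hC : ∑ κ, ‖c κ‖ ≤ C)
    (hsq : ∀ i j, i ≠ j →
      ‖((A * A) i j : ℂ) - n * ∑ κ, c κ * φ κ i * conj (φ κ j)‖ ≤ η * n)
    {w : Fin n → ℝ} (hw : ∑ j, w j ^ 2 = 1)
    (horth : ∀ κ, ‖∑ i, (w i : ℂ) * φ κ i‖ ≤ ρ * √n) :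
    ∑ j, (A.mulVec (A.mulVec w) j) ^ 2 ≤
      2 * (C * ρ + η) ^ 2 * (n : ℝ) ^ 4 + 2 * (1 + C) ^ 2 * (n : ℝ) ^ 2 := by
  have hC0 : 0 ≤ C := (Finset.sum_nonneg fun _ _ => norm_nonneg _).trans hC
  set B : Fin n → Fin n → ℂ := fun i j => n * ∑ κ, c κ * φ κ i * conj (φ κ j) with hB
  have hBnorm : ∀ i j, ‖B i j‖ ≤ n * C := by
    intro i j
    rw [hB]
    simp only [norm_mul, Complex.norm_natCast]
    refine mul_le_mul_of_nonneg_left (((norm_sum_le _ _).trans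
      (Finset.sum_le_sum fun κ _ => ?_)).trans hC) (by positivity)
    rw [norm_mul, norm_mul, RCLike.norm_conj, mul_assoc]
    exact mul_le_of_le_one_right (norm_nonneg _)
      (mul_le_one₀ (hφ κ i) (norm_nonneg _) (hφ κ j))
  have hdiag : ∀ i j, |(A * A) i j| ≤ n := by
    intro i j
    rw [Matrix.mul_apply]
    refine (Finset.abs_sum_le_sum_abs _ _).trans ?_
    calc ∑ k, |A i k * A k j| ≤ ∑ _k : Fin n, (1 : ℝ) := Finset.sum_le_sum fun k _ => by
          rw [abs_mul]; exact mul_le_one₀ (hentry _ _) (abs_nonneg _) (hentry _ _)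
      _ = n := by simp
  -- Nothing is assumed about the diagonal of `A * A`. The trivial bound suffices there, since it
  -- contributes order `n ^ 2` to a sum that is compared with `n ^ 4`.
  have hdiff : ∀ i j, ‖((A * A) i j : ℂ) - B i j‖ ≤ η * n + if i = j then n * (1 + C) else 0 := by
    intro i j
    by_cases hij : i = j
    · rw [if_pos hij]
      refine (norm_sub_le _ _).trans ?_
      rw [Complex.norm_real, Real.norm_eq_abs]
      have := hdiag i j
      have := hBnorm i j
      have : 0 ≤ η * n := by positivity
      linarith
    · rw [if_neg hij, add_zero]; exact hsq i j hij
  have hBw : ∀ i, ‖∑ j, B i j * w j‖ ≤ n * (C * (ρ * √n)) := by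
    intro i
    have : ∑ j, B i j * w j = n * ∑ κ, c κ * φ κ i * conj (∑ j, (w j : ℂ) * φ κ j) := by
      simp_rw [hB, mul_assoc, ← Finset.mul_sum, Finset.sum_mul, map_sum, map_mul,
        Complex.conj_ofReal, Finset.mul_sum]
      rw [Finset.sum_comm]
      refine Finset.sum_congr rfl fun κ _ => Finset.sum_congr rfl fun j _ => by ring
    rw [this, norm_mul, Complex.norm_natCast]
    refine mul_le_mul_of_nonneg_left ((norm_sum_le _ _).trans ?_) (by positivity)
    refine le_trans ?_ (mul_le_mul_of_nonneg_right hC (by positivity))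
    rw [Finset.sum_mul]
    refine Finset.sum_le_sum fun κ _ => ?_
    rw [norm_mul, norm_mul, RCLike.norm_conj]
    exact mul_le_mul (mul_le_of_le_one_right (norm_nonneg _) (hφ κ i)) (horth κ)
      (norm_nonneg _) (norm_nonneg _)
  have habs : ∀ i, |A.mulVec (A.mulVec w) i| ≤
      (C * ρ + η) * (n * √n) + n * (1 + C) * |w i| := by
    intro i
    have hmv : (A.mulVec (A.mulVec w) i : ℂ) =
        ∑ j, (((A * A) i j : ℂ) - B i j) * w j + ∑ j, B i j * w j := by
      rw [← Finset.sum_add_distrib, Matrix.mulVec_mulVec]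
      simp only [Matrix.mulVec, dotProduct]
      push_cast
      exact Finset.sum_congr rfl fun j _ => by ring
    have h1 : ‖∑ j, (((A * A) i j : ℂ) - B i j) * w j‖ ≤ η * n * √n + n * (1 + C) * |w i| := by
      calc _ ≤ ∑ j, (η * n + if i = j then n * (1 + C) else 0) * |w j| :=
            norm_sum_le_of_le _ fun j _ => by
              rw [norm_mul, Complex.norm_real, Real.norm_eq_abs]
              exact mul_le_mul_of_nonneg_right (hdiff i j) (abs_nonneg _)
        _ = η * n * ∑ j, |w j| + n * (1 + C) * |w i| := by
            simp [add_mul, Finset.sum_add_distrib, Finset.mul_sum]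
        _ ≤ _ := by
            have := sum_abs_le_sqrt_mul zero_le_one (r := 1) (w := w) (by simp [hw])
            rw [mul_one] at this
            gcongr
    have h2 : |A.mulVec (A.mulVec w) i| = ‖(A.mulVec (A.mulVec w) i : ℂ)‖ := by simp
    rw [h2, hmv]
    refine (norm_add_le _ _).trans ((add_le_add h1 (hBw i)).trans (le_of_eq (by ring)))
  calc ∑ j, (A.mulVec (A.mulVec w) j) ^ 2
      ≤ ∑ j, (2 * ((C * ρ + η) * (n * √n)) ^ 2 + 2 * (n * (1 + C)) ^ 2 * w j ^ 2) := by
        refine Finset.sum_le_sum fun j _ => ?_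
        rw [← sq_abs]
        refine (pow_le_pow_left₀ (abs_nonneg _) (habs j) 2).trans ?_
        rw [mul_assoc 2, ← sq_abs (w j), ← mul_pow, ← mul_add]
        exact add_sq_le
    _ = 2 * (C * ρ + η) ^ 2 * (n : ℝ) ^ 4 + 2 * (1 + C) ^ 2 * (n : ℝ) ^ 2 := by
        rw [Finset.sum_add_distrib, ← Finset.mul_sum _ (fun j => w j ^ 2), hw]
        simp only [Finset.sum_const, Finset.card_univ, Fintype.card_fin, nsmul_eq_mul]
        rw [mul_pow, mul_pow, Real.sq_sqrt (by positivity)]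
        ring

/-- A symmetric matrix with bounded entries, a family of approximate eigenvectors, and a square
close to a matrix of low rank built on that family, has a simple isolated eigenvalue. -/
theorem exists_isolated_eigenvalue (hA : A.IsHermitian) (hentry : ∀ i j, |A i j| ≤ 1)
    (hφ : ∀ κ i, ‖φ κ i‖ ≤ 1) {κ₀ : K} {χ : Fin n → ℝ} {θ₀ δ ε γ η C : ℝ}
    (hχ : ∀ i, φ κ₀ i = χ i) (hχ1 : ∀ i, χ i ^ 2 = 1) (hθ : θ κ₀ = θ₀) (hθ0 : θ₀ ≠ 0)
    (hδ : 0 < δ) (hγ : 0 < γ) (hη : 0 ≤ η) (hC : ∑ κ, ‖c κ‖ ≤ C)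
    (hsep : ∀ κ, κ ≠ κ₀ → γ ≤ ‖θ κ - θ₀‖) (hεδ : 3 * δ ≤ ε) (hεθ : ε ≤ |θ₀| / 2)
    (hηθ : η ≤ θ₀ ^ 2 / 16) (hCθ : C * ((δ + ε) / γ) ≤ θ₀ ^ 2 / 16)
    (hn : 64 * (1 + C) ^ 2 < θ₀ ^ 4 * (n : ℝ) ^ 2)
    (hE : ∀ κ i, ‖∑ j, (A i j : ℂ) * φ κ j - n * θ κ * φ κ i‖ ≤ δ * n)
    (hsq : ∀ i j, i ≠ j →
      ‖((A * A) i j : ℂ) - n * ∑ κ, c κ * φ κ i * conj (φ κ j)‖ ≤ η * n) :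
    ∃ t : ℝ, IsEigenvalue A t ∧ eigenvalueMultiplicity A t = 1 ∧
      ∀ s : ℝ, IsEigenvalue A s → s ≠ t →
        |t - n * θ₀| < |s - n * θ₀| ∧ ε / 2 * n ≤ |s - t| ∧ ε / 2 * n ≤ |s - n * θ₀| := by
  have hn0 : 0 < n := by
    rcases Nat.eq_zero_or_pos n with rfl | h
    · exfalso
      have : 0 ≤ 64 * (1 + C) ^ 2 := by positivity
      simp at hn
      linarith
    · exact h
  have hn' : (0 : ℝ) < n := by exact_mod_cast hn0
  have hε : 0 < ε := by linarith
  have hC0 : 0 ≤ C := (Finset.sum_nonneg fun _ _ => norm_nonneg _).trans hC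
  have hχsum : ∑ i, χ i ^ 2 = n := by simp [hχ1]
  obtain ⟨i, hi⟩ : ∃ i, |hA.eigenvalues i - n * θ₀| ≤ δ * n := by
    refine hA.exists_eigenvalue_near (v := χ) (by positivity) (by rw [hχsum]; exact hn') ?_
    rw [hχsum]
    have hcard := Finset.sum_le_card_nsmul Finset.univ
      (fun j => (A.mulVec χ j - n * θ₀ * χ j) ^ 2) ((δ * n) ^ 2) fun j _ => by
        rw [← sq_abs]
        refine pow_le_pow_left₀ (abs_nonneg _) ?_ 2
        have := hE κ₀ j
        simp only [hχ, hθ] at this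
        rw [← Real.norm_eq_abs, ← Complex.norm_real]
        have heq : ((A.mulVec χ j - n * θ₀ * χ j : ℝ) : ℂ) =
            ∑ k, (A j k : ℂ) * χ k - n * θ₀ * χ j := by
          simp only [Matrix.mulVec, dotProduct]
          push_cast
          rfl
        rw [heq]
        exact this
    exact hcard.trans (le_of_eq (by simp [mul_comm]))
  -- A second eigenvalue within `ε * n` would give `w` orthogonal to `χ`, hence nearly orthogonal to
  -- all modes, and the two bounds on the norm of `A² w` would conflict.
  have huniq : ∀ i', i' ≠ i → ε * n < |hA.eigenvalues i' - n * θ₀| := by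
    intro i' hne
    by_contra! hi'
    have habs : |(n : ℝ) * θ₀| = n * |θ₀| := by rw [abs_mul, abs_of_pos hn']
    obtain ⟨w, hw, hwχ, happ, hlow⟩ := hA.exists_orthogonal_combination hne.symm (r := ε * n)
      (by rw [habs]; nlinarith [abs_nonneg θ₀]) (hi.trans (by nlinarith)) hi' χ
    have hup := sum_sq_mulVec_mulVec_le hentry hφ hη (ρ := (δ + ε) / γ) (by positivity) hC hsq hw
      (fun κ => by
        by_cases hκ : κ = κ₀
        · subst hκ
          have : ∑ j, (w j : ℂ) * φ κ j = 0 := by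
            rw [← Complex.ofReal_zero, ← hwχ]
            push_cast
            exact Finset.sum_congr rfl fun j _ => by rw [hχ, mul_comm]
          rw [this, norm_zero]
          positivity
        · exact norm_sum_mul_le_of_approx_eigenvector hA hn0 hγ hε.le hδ.le (hφ κ) (hE κ)
            (hsep κ hκ) hw happ)
    -- The lower bound is `θ₀ ^ 4 * n ^ 4 / 16`. Half of it dominates the off-diagonal error, by
    -- `hηθ` and `hCθ`, and the other half strictly dominates the diagonal error, by `hn`.
    have h1 : (|θ₀| / 2 * n) ^ 4 ≤ (|(n : ℝ) * θ₀| - ε * n) ^ 4 := by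
      refine pow_le_pow_left₀ (by positivity) ?_ 4
      rw [habs]; nlinarith
    have h2 : (|θ₀| / 2 * n) ^ 4 = θ₀ ^ 4 * n ^ 4 / 16 := by
      have : |θ₀| ^ 4 = θ₀ ^ 4 := by rw [← abs_pow, abs_of_nonneg (by positivity)]
      rw [mul_pow, div_pow, this]; ring
    have h3 : (C * ((δ + ε) / γ) + η) ^ 2 ≤ (θ₀ ^ 2 / 8) ^ 2 :=
      pow_le_pow_left₀ (by positivity) (by linarith) 2
    have h4 : 2 * (C * ((δ + ε) / γ) + η) ^ 2 * (n : ℝ) ^ 4 ≤ θ₀ ^ 4 / 32 * n ^ 4 := by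
      refine mul_le_mul_of_nonneg_right ?_ (by positivity)
      calc _ ≤ 2 * (θ₀ ^ 2 / 8) ^ 2 := by linarith
        _ = _ := by ring
    have h5 : 2 * (1 + C) ^ 2 * (n : ℝ) ^ 2 < θ₀ ^ 4 / 32 * n ^ 4 := by
      have := mul_lt_mul_of_pos_right hn (show (0 : ℝ) < n ^ 2 by positivity)
      calc _ = 64 * (1 + C) ^ 2 * (n : ℝ) ^ 2 / 32 := by ring
        _ < θ₀ ^ 4 * n ^ 2 * n ^ 2 / 32 := by linarith
        _ = _ := by ring
    linarith
  refine ⟨hA.eigenvalues i, hA.isEigenvalue_iff.2 ⟨i, rfl⟩,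
    hA.eigenvalueMultiplicity_eq_one fun i' hne heq => ?_, fun s hs hst => ?_⟩
  · have := huniq i' hne
    rw [heq] at this
    nlinarith
  · obtain ⟨i', rfl⟩ := hA.isEigenvalue_iff.1 hs
    have hfar := huniq i' fun h => hst (by rw [h])
    have htri := abs_sub_le (hA.eigenvalues i') (hA.eigenvalues i) (n * θ₀)
    -- As `δ ≤ ε / 3`, the distance from `s` to `t` is at least `(ε - δ) * n`, which exceeds `ε / 2
    -- * n`.
    have hδn : 3 * (δ * n) ≤ ε * n := by nlinarith
    have : 0 < ε * n := by positivity
    exact ⟨by linarith, by linarith, by linarith⟩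

end Deterministic

/-! ### Hoeffding bounds on product spaces, plain and conditional. -/

section Hoeffding

variable {ι α : Type*} [Fintype ι] [MeasurableSpace α] {μ : Measure α} [IsProbabilityMeasure μ]

/-- Hoeffding's inequality for functions of the coordinates of a product space. -/
lemma measure_pi_sum_ge_le {g : ι → α → ℝ} (hg : ∀ k, Measurable (g k))
    (hb : ∀ k x, |g k x| ≤ 1) {N : ℕ} (hN : Fintype.card ι ≤ N) {t : ℝ} (ht : 0 < t) :
    Measure.pi (fun _ : ι => μ) {ω | t ≤ ∑ k, (g k (ω k) - ∫ x, g k x ∂μ)} ≤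
      ENNReal.ofReal (Real.exp (-t ^ 2 / (2 * N))) := by
  -- The exponent of the inequality divides by the number of summands, so an empty sum is treated
  -- apart.
  rcases Nat.eq_zero_or_pos (Fintype.card ι) with h0 | hpos
  · have : IsEmpty ι := Fintype.card_eq_zero_iff.1 h0
    simp [ht.not_ge]
  have hindep : iIndepFun (fun k (ω : ι → α) => g k (ω k) - ∫ x, g k x ∂μ)
      (Measure.pi (fun _ : ι => μ)) :=
    iIndepFun_pi (X := fun k x => g k x - ∫ x, g k x ∂μ)
      fun k => ((hg k).sub_const _).aemeasurable
  have hsub : ∀ k ∈ (Finset.univ : Finset ι),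
      HasSubgaussianMGF (fun ω : ι → α => g k (ω k) - ∫ x, g k x ∂μ) 1
        (Measure.pi (fun _ : ι => μ)) := by
    intro k _
    have h := hasSubgaussianMGF_of_mem_Icc (μ := Measure.pi (fun _ : ι => μ)) (a := -1) (b := 1)
      (X := fun ω => g k (ω k)) ((hg k).comp (measurable_pi_apply k)).aemeasurable
      (ae_of_all _ fun ω => abs_le.1 (hb k _))
    have hint : ∫ ω, g k (ω k) ∂(Measure.pi fun _ : ι => μ) = ∫ x, g k x ∂μ := by
      have hmp := measurePreserving_eval (fun _ : ι => μ) k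
      have h' := integral_map (f := g k) hmp.aemeasurable (hg k).aestronglyMeasurable
      rw [hmp.map_eq] at h'
      exact h'.symm
    rw [hint] at h
    -- The variance proxy is the squared half-length of `[-1, 1]`, which is 1.
    convert h using 1
    ext
    simp
    norm_num
  have h := HasSubgaussianMGF.measure_sum_ge_le_of_iIndepFun hindep hsub ht.le
  rw [← ENNReal.ofReal_toReal (measure_ne_top (Measure.pi (fun _ : ι => μ)) _)]
  refine ENNReal.ofReal_le_ofReal (h.trans (Real.exp_le_exp.2 ?_))
  have hcard : (0 : ℝ) < Fintype.card ι := by exact_mod_cast hpos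
  have hcN : (Fintype.card ι : ℝ) ≤ N := by exact_mod_cast hN
  simp only [Finset.sum_const, Finset.card_univ, nsmul_eq_mul, mul_one, NNReal.coe_natCast]
  rw [neg_div, neg_div, neg_le_neg_iff]
  gcongr

/-- If the modulus reaches `t`, the real or the imaginary part reaches `t / 2` in absolute value.
This makes four one-sided tails, with exponent `(t / 2) ^ 2 / (2 * N)`. -/
lemma measure_pi_norm_sum_ge_le {g : ι → α → ℂ} (hg : ∀ k, Measurable (g k))
    (hb : ∀ k x, ‖g k x‖ ≤ 1) {N : ℕ} (hN : Fintype.card ι ≤ N) {t : ℝ} (ht : 0 < t) :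
    Measure.pi (fun _ : ι => μ) {ω | t ≤ ‖∑ k, (g k (ω k) - ∫ x, g k x ∂μ)‖} ≤
      4 * ENNReal.ofReal (Real.exp (-t ^ 2 / (8 * N))) := by
  have hint : ∀ k, Integrable (g k) μ := fun k =>
    Integrable.of_bound (hg k).aestronglyMeasurable 1 (ae_of_all _ (hb k))
  have hre : ∀ k, (∫ x, g k x ∂μ).re = ∫ x, (g k x).re ∂μ := fun k =>
    (integral_re (hint k)).symm
  have him : ∀ k, (∫ x, g k x ∂μ).im = ∫ x, (g k x).im ∂μ := fun k =>
    (integral_im (hint k)).symm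
  have hre_m : ∀ k, Measurable fun x => (g k x).re := fun k => Complex.measurable_re.comp (hg k)
  have him_m : ∀ k, Measurable fun x => (g k x).im := fun k => Complex.measurable_im.comp (hg k)
  have hre_b : ∀ k x, |(g k x).re| ≤ 1 := fun k x => (Complex.abs_re_le_norm _).trans (hb k x)
  have him_b : ∀ k x, |(g k x).im| ≤ 1 := fun k x => (Complex.abs_im_le_norm _).trans (hb k x)
  have key : ∀ f : ι → α → ℝ, (∀ k, Measurable (f k)) → (∀ k x, |f k x| ≤ 1) →
      Measure.pi (fun _ : ι => μ) {ω | t / 2 ≤ |∑ k, (f k (ω k) - ∫ x, f k x ∂μ)|} ≤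
      2 * ENNReal.ofReal (Real.exp (-t ^ 2 / (8 * N))) := by
    intro f hf hfb
    have hexp : -(t / 2) ^ 2 / (2 * (N : ℝ)) = -t ^ 2 / (8 * N) := by
      rw [div_pow, ← neg_div, div_div]; congr 1; ring
    have h1 := measure_pi_sum_ge_le (μ := μ) hf hfb hN (half_pos ht)
    have h2 := measure_pi_sum_ge_le (μ := μ) (g := fun k x => -f k x) (fun k => (hf k).neg)
      (fun k x => by rw [abs_neg]; exact hfb k x) hN (half_pos ht)
    rw [hexp] at h1 h2
    rw [two_mul]
    refine (measure_mono fun ω hω => ?_).trans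
      ((measure_union_le _ _).trans (add_le_add h1 h2))
    rcases le_abs.1 (Set.mem_ofPred_eq ▸ hω : t / 2 ≤ |_|) with h | h
    · exact Or.inl h
    · refine Or.inr (h.trans (le_of_eq ?_))
      simp only [integral_neg]
      rw [← Finset.sum_neg_distrib]
      exact Finset.sum_congr rfl fun k _ => by ring
  calc _ ≤ Measure.pi (fun _ : ι => μ)
        ({ω | t / 2 ≤ |∑ k, ((g k (ω k)).re - ∫ x, (g k x).re ∂μ)|} ∪
          {ω | t / 2 ≤ |∑ k, ((g k (ω k)).im - ∫ x, (g k x).im ∂μ)|}) := by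
        refine measure_mono fun ω hω => ?_
        have hω' : t ≤ ‖∑ k, (g k (ω k) - ∫ x, g k x ∂μ)‖ := hω
        have h := hω'.trans (Complex.norm_le_abs_re_add_abs_im _)
        simp only [Complex.re_sum, Complex.im_sum, Complex.sub_re, Complex.sub_im, hre, him] at h
        by_contra hcon
        simp only [Set.mem_union, Set.mem_ofPred_eq, not_or, not_le] at hcon
        linarith
    _ ≤ _ := by
        refine (measure_union_le _ _).trans
          ((add_le_add (key _ hre_m hre_b) (key _ him_m him_b)).trans (le_of_eq ?_))
        ring

/-- Conditional Hoeffding inequality: the coordinates where `p` holds enter every summand. -/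
lemma measure_pi_norm_sum_ge_le_of_fixed (p : ι → Prop) [DecidablePred p]
    {g : ({k // p k} → α) → ι → α → ℂ} (hg : ∀ k, Measurable fun z : _ × α => g z.1 k z.2)
    (hb : ∀ y k x, ‖g y k x‖ ≤ 1) {N : ℕ} (hN : Fintype.card ι ≤ N) {t : ℝ} (ht : 0 < t) :
    Measure.pi (fun _ : ι => μ)
      {ω | t ≤ ‖∑ k : {k // ¬ p k}, (g (fun l => ω l) k (ω k) -
        ∫ x, g (fun l => ω l) k x ∂μ)‖} ≤
      4 * ENNReal.ofReal (Real.exp (-t ^ 2 / (8 * N))) := by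
  -- By Fubini, the coordinates where `p` holds are frozen and the unconditional bound is applied on
  -- each slice.
  have hmp := measurePreserving_piEquivPiSubtypeProd (fun _ : ι => μ) p
  set S : Set (({k // p k} → α) × ({k // ¬ p k} → α)) :=
    {y | t ≤ ‖∑ k : {k // ¬ p k}, (g y.1 k (y.2 k) - ∫ x, g y.1 k x ∂μ)‖} with hS
  have hmeas : MeasurableSet S := by
    refine measurableSet_le measurable_const (Measurable.norm ?_)
    refine Finset.measurable_sum _ fun k _ => Measurable.sub ?_ ?_
    · exact (hg k).comp (measurable_fst.prodMk ((measurable_pi_apply k).comp measurable_snd))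
    · exact ((hg k).stronglyMeasurable.integral_prod_right'.measurable).comp measurable_fst
  have hpre := hmp.measure_preimage hmeas.nullMeasurableSet
  refine (le_of_eq hpre).trans ?_
  rw [Measure.prod_apply hmeas]
  refine (lintegral_mono (g := fun _ => 4 * ENNReal.ofReal (Real.exp (-t ^ 2 / (8 * N))))
    fun y => ?_).trans (by simp)
  exact measure_pi_norm_sum_ge_le (μ := μ) (g := fun k : {k // ¬ p k} => g y k)
    (fun k => (hg k).comp measurable_prodMk_left) (fun k x => hb _ _ _)
    ((Fintype.card_subtype_le _).trans hN) ht

end Hoeffding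

/-! ### Normalisation of the torus measure; graphs as measurable points. -/

instance isProbabilityMeasure_unitAddCircle :
    IsProbabilityMeasure (volume : Measure UnitAddCircle) :=
  ⟨by simp [AddCircle.measure_univ]⟩

instance isProbabilityMeasure_unitAddTorus (d : ℕ) :
    IsProbabilityMeasure (volume : Measure (UnitAddTorus (Fin d))) :=
  inferInstanceAs (IsProbabilityMeasure (Measure.pi fun _ : Fin d =>
    (volume : Measure UnitAddCircle)))

instance measurableSingletonClass_simpleGraph (n : ℕ) :
    MeasurableSingletonClass (SimpleGraph (Fin n)) := by
  refine ⟨fun G => ?_⟩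
  have : ({G} : Set (SimpleGraph (Fin n))) = ⋂ a, ⋂ b, {H | H.Adj a b ↔ G.Adj a b} := by
    ext H
    simp only [Set.mem_singleton_iff, Set.mem_iInter, Set.mem_ofPred_eq]
    exact ⟨fun h a b => by rw [h], fun h => by ext a b; exact h a b⟩
  rw [this]
  refine MeasurableSet.iInter fun a => MeasurableSet.iInter fun b => ?_
  exact measurableSet_setOfPred.2
    ((SimpleGraph.measurable_iff_adj.1 measurable_id a b).iff measurable_const)

/-! ### Random graphs from independent uniform variables. -/

section Coupling

variable {n : ℕ}

/-- The graph in which the pair `{k, l}` is an edge when the uniform variable attached to the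
orientation of that pair selected by `R` falls below the threshold `p k l`. -/
def thresholdGraph (R : Fin n → Fin n → Prop) (p : Fin n → Fin n → ℝ)
    (u : Fin n → Fin n → unitInterval) : SimpleGraph (Fin n) :=
  SimpleGraph.fromRel fun k l => R k l ∧ (u k l : ℝ) < p k l

lemma thresholdGraph_adj_of_rel {R : Fin n → Fin n → Prop} {p : Fin n → Fin n → ℝ}
    {u : Fin n → Fin n → unitInterval} (hR : ∀ k l, R k l → ¬ R l k) {k l : Fin n}
    (hkl : R k l) : (thresholdGraph R p u).Adj k l ↔ (u k l : ℝ) < p k l := by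
  have hne : k ≠ l := fun h => hR k l hkl (h ▸ h ▸ hkl)
  simp [thresholdGraph, hne, hkl, hR k l hkl]

lemma volume_unitInterval_coe_lt {p : ℝ} (h0 : 0 ≤ p) (h1 : p ≤ 1) :
    volume {u : unitInterval | (u : ℝ) < p} = ENNReal.ofReal p := by
  have : {u : unitInterval | (u : ℝ) < p} = Set.Iio (⟨p, h0, h1⟩ : unitInterval) := rfl
  rw [this, unitInterval.volume_Iio]

-- Since `R` selects one orientation of each pair, the event is a box and its volume a product over
-- pairs. The value does not involve `R`, so the orientation is free to vary with the event under
-- study.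
open Classical in
lemma volume_thresholdGraph_eq {R : Fin n → Fin n → Prop} (hR : ∀ k l, R k l → ¬ R l k)
    (hR' : ∀ k l, k ≠ l → R k l ∨ R l k) {p : Fin n → Fin n → ℝ}
    (hp : ∀ k l, p k l = p l k) (h0 : ∀ k l, 0 ≤ p k l) (h1 : ∀ k l, p k l ≤ 1)
    (G : SimpleGraph (Fin n)) :
    volume {u | thresholdGraph R p u = G} = ENNReal.ofReal
      (∏ i : Fin n, ∏ j ∈ Finset.Ioi i, if G.Adj i j then p i j else 1 - p i j) := by
  set q : Fin n → Fin n → ℝ := fun i j => if G.Adj i j then p i j else 1 - p i j with hq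
  have hqsymm : ∀ i j, q i j = q j i := fun i j => by simp only [hq, G.adj_comm i j, hp i j]
  have hq0 : ∀ i j, 0 ≤ q i j := fun i j => by
    simp only [hq]; split_ifs
    · exact h0 i j
    · linarith [h1 i j]
  set S : Fin n → Fin n → Set unitInterval :=
    fun k l => {u | R k l → ((u : ℝ) < p k l ↔ G.Adj k l)} with hS
  have hset : {u | thresholdGraph R p u = G} =
      Set.univ.pi fun k => Set.univ.pi fun l => S k l := by
    ext u
    simp only [Set.mem_ofPred_eq, Set.mem_pi, Set.mem_univ, true_implies, hS]
    constructor
    · rintro h k l hkl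
      rw [← thresholdGraph_adj_of_rel hR hkl, h]
    · intro h
      ext k l
      by_cases hkl : k = l
      · subst hkl; simp
      · rcases hR' k l hkl with hr | hr
        · rw [thresholdGraph_adj_of_rel hR hr, h k l hr]
        · rw [SimpleGraph.adj_comm, thresholdGraph_adj_of_rel hR hr, h l k hr, G.adj_comm]
  have hvol : ∀ k l, volume (S k l) = if R k l then ENNReal.ofReal (q k l) else 1 := by
    intro k l
    by_cases hkl : R k l
    · rw [if_pos hkl]
      by_cases hG : G.Adj k l
      · simp only [hS, hkl, hG, hq, true_implies, iff_true, if_true]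
        exact volume_unitInterval_coe_lt (h0 k l) (h1 k l)
      · simp only [hS, hkl, hG, hq, true_implies, iff_false, if_false]
        have hc : {u : unitInterval | ¬ (u : ℝ) < p k l} = {u : unitInterval | (u : ℝ) < p k l}ᶜ :=
          rfl
        rw [hc, prob_compl_eq_one_sub (measurableSet_lt measurable_subtype_coe measurable_const),
          volume_unitInterval_coe_lt (h0 k l) (h1 k l),
          ENNReal.ofReal_sub _ (h0 k l), ENNReal.ofReal_one]
    · simp [hS, hkl]
  rw [hset, volume_pi_pi]
  simp_rw [volume_pi_pi, hvol]
  rw [ENNReal.ofReal_prod_of_nonneg fun i _ => Finset.prod_nonneg fun j _ => hq0 i j]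
  simp_rw [ENNReal.ofReal_prod_of_nonneg fun j _ => hq0 _ j]
  have hdiag : ∀ i : Fin n, ∏ j, (if R i j then ENNReal.ofReal (q i j) else 1) =
      ∏ j ∈ {i}ᶜ, (if R i j then ENNReal.ofReal (q i j) else 1) := by
    intro i
    refine (Finset.prod_subset (Finset.subset_univ _) fun j _ hj => ?_).symm
    have hji : j = i := by simpa using hj
    subst hji
    rw [if_neg fun h => hR j j h h]
  simp_rw [hdiag]
  -- Both orientations of a pair appear in the off-diagonal product; exactly one carries the factor
  -- `q`, the other is 1.
  rw [← Finset.prod_prod_Ioi_mul_eq_prod_prod_off_diag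
    (fun j i => if R i j then ENNReal.ofReal (q i j) else 1)]
  refine Finset.prod_congr rfl fun i _ => Finset.prod_congr rfl fun j hj => ?_
  have hij : i ≠ j := (Finset.mem_Ioi.1 hj).ne
  rcases hR' i j hij with h | h
  · rw [if_pos h, if_neg (hR i j h), mul_one]
  · rw [if_pos h, if_neg (hR j i h), one_mul, hqsymm]

lemma measurable_thresholdGraph (R : Fin n → Fin n → Prop) {Ω : Type*} [MeasurableSpace Ω]
    {p : Ω → Fin n → Fin n → ℝ} {u : Ω → Fin n → Fin n → unitInterval}
    (hp : ∀ k l, Measurable fun ω => p ω k l) (hu : ∀ k l, Measurable fun ω => u ω k l) :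
    Measurable fun ω => thresholdGraph R (p ω) (u ω) := by
  refine SimpleGraph.measurable_iff_adj.2 fun a b => ?_
  have h : ∀ k l, Measurable fun ω => R k l ∧ ((u ω k l : ℝ) < p ω k l) := fun k l =>
    measurable_const.and (measurableSet_setOfPred.1
      (measurableSet_lt (measurable_subtype_coe.comp (hu k l)) (hp k l)))
  simp only [thresholdGraph, SimpleGraph.fromRel_adj]
  exact measurable_const.and ((h a b).or (h b a))

end Coupling

/-! ### The block model law realised by the coupling. -/

section Law

variable {d n : ℕ} {F_in F_out : UnitAddTorus (Fin d) → ℝ}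

/-- Randomness attached to one node: its position, and a uniform variable for each other node. -/
abbrev NodeSpace (d n : ℕ) : Type := UnitAddTorus (Fin d) × (Fin n → unitInterval)

/-- Connection probabilities given labels and positions. -/
def connectionMatrix (F_in F_out : UnitAddTorus (Fin d) → ℝ) (σ : Fin n → Fin 2)
    (X : Fin n → UnitAddTorus (Fin d)) (k l : Fin n) : ℝ :=
  connectivity F_in F_out (X k - X l) (σ k) (σ l)

/-- The block model graph as a function of labels and independent node variables. -/
def coupledGraph (R : Fin n → Fin n → Prop) (F_in F_out : UnitAddTorus (Fin d) → ℝ)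
    (σ : Fin n → Fin 2) (ω : Fin n → NodeSpace d n) : SimpleGraph (Fin n) :=
  thresholdGraph R (connectionMatrix F_in F_out σ fun k => (ω k).1) fun k => (ω k).2

/-- Evenness is what the proof takes from radial symmetry: it makes connection probabilities
symmetric and turns their averages into convolutions. -/
lemma IsConnectivityFunction.neg {F : UnitAddTorus (Fin d) → ℝ} (hF : IsConnectivityFunction F)
    (x : UnitAddTorus (Fin d)) : F (-x) = F x :=
  hF.radial _ _ (norm_neg x)

lemma connectivity_mem (h_in : IsConnectivityFunction F_in) (h_out : IsConnectivityFunction F_out)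
    (x : UnitAddTorus (Fin d)) (s s' : Fin 2) :
    0 ≤ connectivity F_in F_out x s s' ∧ connectivity F_in F_out x s s' ≤ 1 := by
  unfold connectivity
  split_ifs
  exacts [⟨h_in.nonneg _, h_in.le_one _⟩, ⟨h_out.nonneg _, h_out.le_one _⟩]

lemma measurable_connectivity (h_in : IsConnectivityFunction F_in)
    (h_out : IsConnectivityFunction F_out) (s s' : Fin 2) :
    Measurable fun x => connectivity F_in F_out x s s' := by
  unfold connectivity
  split_ifs
  exacts [h_in.measurable, h_out.measurable]

lemma connectionMatrix_comm (h_in : IsConnectivityFunction F_in)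
    (h_out : IsConnectivityFunction F_out) (σ : Fin n → Fin 2)
    (X : Fin n → UnitAddTorus (Fin d)) (k l : Fin n) :
    connectionMatrix F_in F_out σ X k l = connectionMatrix F_in F_out σ X l k := by
  unfold connectionMatrix connectivity
  rw [← neg_sub (X l) (X k), h_in.neg, h_out.neg]
  simp only [eq_comm]

lemma measurable_connectionMatrix (h_in : IsConnectivityFunction F_in)
    (h_out : IsConnectivityFunction F_out) (σ : Fin n → Fin 2) (k l : Fin n) :
    Measurable fun X => connectionMatrix F_in F_out σ X k l :=
  (measurable_connectivity h_in h_out (σ k) (σ l)).comp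
    ((measurable_pi_apply k).sub (measurable_pi_apply l))

lemma measurable_graphProbability (h_in : IsConnectivityFunction F_in)
    (h_out : IsConnectivityFunction F_out) (σ : Fin n → Fin 2) (G : SimpleGraph (Fin n)) :
    Measurable fun X => graphProbability F_in F_out σ X G := by
  unfold graphProbability
  refine Finset.measurable_prod _ fun i _ => Finset.measurable_prod _ fun j _ => ?_
  have h := measurable_connectionMatrix h_in h_out σ i j
  split_ifs
  exacts [h, measurable_const.sub h]

/-- The coupled graph and its positions have the law prescribed by `graphProbability`. -/
lemma lintegral_graphProbability_eq (h_in : IsConnectivityFunction F_in)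
    (h_out : IsConnectivityFunction F_out) {R : Fin n → Fin n → Prop}
    (hR : ∀ k l, R k l → ¬ R l k) (hR' : ∀ k l, k ≠ l → R k l ∨ R l k) (σ : Fin n → Fin 2)
    {B : Set ((Fin n → UnitAddTorus (Fin d)) × SimpleGraph (Fin n))} (hB : MeasurableSet B) :
    ∫⁻ X, ∫⁻ G, B.indicator (fun z => ENNReal.ofReal (graphProbability F_in F_out σ z.1 z.2)) (X, G)
        ∂Measure.count =
      Measure.pi (fun _ : Fin n => (volume : Measure (NodeSpace d n)))
        {ω | ((fun k => (ω k).1), coupledGraph R F_in F_out σ ω) ∈ B} := by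
  classical
  have hmp := volume_measurePreserving_arrowProdEquivProdArrow (UnitAddTorus (Fin d))
    (Fin n → unitInterval) (Fin n)
  set S : Set ((Fin n → UnitAddTorus (Fin d)) × (Fin n → Fin n → unitInterval)) :=
    {y | (y.1, thresholdGraph R (connectionMatrix F_in F_out σ y.1) y.2) ∈ B} with hS
  have hmeas : MeasurableSet S := by
    refine (measurable_fst.prodMk (measurable_thresholdGraph R (fun k l => ?_) fun k l => ?_)) hB
    · exact (measurable_connectionMatrix h_in h_out σ k l).comp measurable_fst
    · exact (measurable_pi_apply l).comp ((measurable_pi_apply k).comp measurable_snd)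
  have hpre := hmp.measure_preimage hmeas.nullMeasurableSet
  refine Eq.trans ?_ hpre.symm
  rw [Measure.volume_eq_prod, Measure.prod_apply hmeas]
  refine lintegral_congr fun X => ?_
  rw [lintegral_count, tsum_fintype]
  have hunion : Prod.mk X ⁻¹' S = ⋃ G : SimpleGraph (Fin n),
      {u | (X, G) ∈ B ∧ thresholdGraph R (connectionMatrix F_in F_out σ X) u = G} := by
    ext u
    simp [hS]
  have hmeas' : ∀ G : SimpleGraph (Fin n), MeasurableSet
      {u | (X, G) ∈ B ∧ thresholdGraph R (connectionMatrix F_in F_out σ X) u = G} := by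
    intro G
    refine MeasurableSet.inter (MeasurableSet.const _) ?_
    exact measurable_thresholdGraph R (p := fun _ => connectionMatrix F_in F_out σ X) (u := id)
      (fun k l => measurable_const)
      (fun k l => (measurable_pi_apply l).comp (measurable_pi_apply k))
      (measurableSet_singleton G)
  rw [hunion, measure_iUnion _ hmeas', tsum_fintype]
  · refine Finset.sum_congr rfl fun G _ => ?_
    by_cases hG : (X, G) ∈ B
    · rw [Set.indicator_of_mem hG]
      simp only [hG, true_and]
      rw [volume_thresholdGraph_eq hR hR' (connectionMatrix_comm h_in h_out σ X)
        (fun k l => (connectivity_mem h_in h_out _ _ _).1)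
        (fun k l => (connectivity_mem h_in h_out _ _ _).2)]
      rfl
    · rw [Set.indicator_of_notMem hG]
      simp [hG]
  · intro G G' hne
    refine Set.disjoint_left.2 fun u hu hu' => hne ?_
    exact hu.2.symm.trans hu'.2

/-- A bound on an event in the coupled model, uniform over balanced labellings, is a bound in the
block model. -/
lemma sgbmLaw_le_of_forall_balanced (h_in : IsConnectivityFunction F_in)
    (h_out : IsConnectivityFunction F_out) {R : Fin n → Fin n → Prop}
    (hR : ∀ k l, R k l → ¬ R l k) (hR' : ∀ k l, k ≠ l → R k l ∨ R l k)
    {B : Set ((Fin n → Fin 2) × (Fin n → UnitAddTorus (Fin d)) × SimpleGraph (Fin n))}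
    (hB : MeasurableSet B) {c : ENNReal}
    (hc : ∀ σ ∈ balancedLabellings n,
      Measure.pi (fun _ : Fin n => (volume : Measure (NodeSpace d n)))
        {ω | (σ, (fun k => (ω k).1), coupledGraph R F_in F_out σ ω) ∈ B} ≤ c) :
    sgbmLaw n F_in F_out B ≤ c := by
  have hdens : Measurable fun z : (Fin n → Fin 2) × (Fin n → UnitAddTorus (Fin d)) ×
      SimpleGraph (Fin n) => ENNReal.ofReal (graphProbability F_in F_out z.1 z.2.1 z.2.2) := by
    refine ENNReal.measurable_ofReal.comp ?_
    refine measurable_from_prod_countable_right fun σ => ?_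
    exact measurable_from_prod_countable_left fun G => measurable_graphProbability h_in h_out σ G
  rw [sgbmLaw, withDensity_apply _ hB, ← lintegral_indicator hB,
    lintegral_prod _ (hdens.indicator hB).aemeasurable]
  have hmem : ∀ᵐ σ ∂(uniformOn (balancedLabellings n)), σ ∈ balancedLabellings n := by
    rw [uniformOn, ProbabilityTheory.cond]
    exact Measure.ae_smul_measure (ae_restrict_mem (Set.toFinite _).measurableSet) _
  -- For odd `n` no labelling is balanced and `uniformOn` is the zero measure, so only an upper
  -- bound on the mass holds in general.
  have hone : uniformOn (balancedLabellings n) Set.univ ≤ 1 := by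
    rcases Set.eq_empty_or_nonempty (balancedLabellings n) with h | h
    · simp [h]
    · have := isProbabilityMeasure_uniformOn (Set.toFinite (balancedLabellings n)) h
      exact prob_le_one
  refine (lintegral_mono_ae (g := fun _ => c) (hmem.mono fun σ hσ => ?_)).trans ?_
  · have hslice : MeasurableSet (Prod.mk σ ⁻¹' B) := measurable_prodMk_left hB
    rw [lintegral_prod]
    · exact (le_of_eq (lintegral_graphProbability_eq h_in h_out hR hR' σ hslice)).trans (hc σ hσ)
    · exact ((hdens.indicator hB).comp measurable_prodMk_left).aemeasurable
  · rw [lintegral_const]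
    exact mul_le_of_le_one_right' hone

end Law

/-! ### Characters, convolutions and trigonometric approximation. -/

section Fourier

open UnitAddTorus ComplexConjugate

variable {d : ℕ}

instance isNegInvariant_unitAddTorus :
    (volume : Measure (UnitAddTorus (Fin d))).IsNegInvariant := by
  have h : (volume : Measure UnitAddCircle).IsNegInvariant := by infer_instance
  exact inferInstanceAs (Measure.pi fun _ : Fin d =>
    (volume : Measure UnitAddCircle)).IsNegInvariant

lemma mFourier_sub_apply (k : Fin d → ℤ) (x y : UnitAddTorus (Fin d)) :
    mFourier k (x - y) = mFourier k x * mFourier (-k) y := by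
  simp only [mFourier, ContinuousMap.coe_mk, ← Finset.prod_mul_distrib]
  refine Finset.prod_congr rfl fun i _ => ?_
  simp [fourier_apply, sub_eq_add_neg, smul_add, AddCircle.toCircle_add]

lemma norm_mFourier_apply (k : Fin d → ℤ) (x : UnitAddTorus (Fin d)) : ‖mFourier k x‖ = 1 := by
  simp only [mFourier, ContinuousMap.coe_mk, fourier_apply, norm_prod]
  exact Finset.prod_eq_one fun i _ => Circle.norm_coe _

/-- Convolution with a character. -/
lemma integral_sub_mul_mFourier (F : UnitAddTorus (Fin d) → ℝ) (k : Fin d → ℤ)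
    (x : UnitAddTorus (Fin d)) :
    ∫ z, (F (x - z) : ℂ) * mFourier k z = torusFourier F k * mFourier k x := by
  rw [← integral_sub_left_eq_self _ volume x, torusFourier, ← integral_mul_const]
  refine integral_congr_ae (ae_of_all _ fun z => ?_)
  simp only [sub_sub_cancel, mFourier_sub_apply]
  ring

lemma torusFourier_zero (F : UnitAddTorus (Fin d) → ℝ) : torusFourier F 0 = edgeDensity F := by
  simp [torusFourier, edgeDensity, mFourier_zero, integral_complex_ofReal]

/-- Trigonometric polynomials are dense in `L¹` of the torus. -/
lemma exists_trigonometric_approx {F : UnitAddTorus (Fin d) → ℂ} (hF : Integrable F) {η : ℝ}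
    (hη : 0 < η) :
    ∃ p : (Fin d → ℤ) →₀ ℂ, ∫ z, ‖F z - p.sum fun k a => a * mFourier k z‖ ≤ η := by
  -- Half of `η` pays for a continuous approximation in `L¹`, the other half for a uniform
  -- approximation of that by characters.
  obtain ⟨g, hg, -⟩ := hF.exists_boundedContinuous_integral_sub_le (half_pos hη)
  have hmem : (g : C(UnitAddTorus (Fin d), ℂ)) ∈
      (Submodule.span ℂ (Set.range (mFourier (d := Fin d)))).topologicalClosure := by
    rw [span_mFourier_closure_eq_top]; trivial
  obtain ⟨q, hq, hdist⟩ := Metric.mem_closure_iff.1 hmem (η / 2) (half_pos hη)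
  obtain ⟨p, rfl⟩ := (Finsupp.mem_span_range_iff_exists_finsupp).1 hq
  have happ : ∀ z, (p.sum fun k a => a • mFourier k : C(UnitAddTorus (Fin d), ℂ)) z =
      p.sum fun k a => a * mFourier k z := by
    intro z
    simp [Finsupp.sum]
  refine ⟨p, ?_⟩
  have hcont : Continuous fun z : UnitAddTorus (Fin d) => p.sum fun k a => a * mFourier k z := by
    simp only [← happ]
    exact ContinuousMap.continuous _
  have hpt : ∀ z, ‖g z - p.sum fun k a => a * mFourier k z‖ ≤ η / 2 := by
    intro z
    rw [← happ, ← dist_eq_norm]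
    exact (ContinuousMap.dist_apply_le_dist (f := (g : C(UnitAddTorus (Fin d), ℂ))) z).trans hdist.le
  have hint : ∀ f : UnitAddTorus (Fin d) → ℂ, Continuous f → Integrable f := fun f hf =>
    hf.integrable_of_hasCompactSupport (HasCompactSupport.of_compactSpace f)
  have hi1 : Integrable fun z => ‖F z - g z‖ := (hF.sub (hint _ g.continuous)).norm
  calc _ ≤ ∫ z, (‖F z - g z‖ + η / 2) := by
        refine integral_mono (hF.sub (hint _ hcont)).norm (hi1.add (integrable_const _)) fun z => ?_
        exact (norm_sub_le_norm_sub_add_norm_sub _ (g z) _).trans (by gcongr; exact hpt z)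
    _ ≤ η := by
        rw [integral_add hi1 (integrable_const _)]
        simp only [integral_const, probReal_univ, one_smul]
        linarith

lemma IsConnectivityFunction.integrable {F : UnitAddTorus (Fin d) → ℝ}
    (hF : IsConnectivityFunction F) : Integrable F :=
  Integrable.of_bound hF.measurable.aestronglyMeasurable 1 (ae_of_all _ fun x => by
    rw [Real.norm_eq_abs, abs_of_nonneg (hF.nonneg x)]; exact hF.le_one x)

/-- The convolution of two connectivity functions is uniformly close to a trigonometric
polynomial in the difference of the arguments. -/
lemma norm_integral_sub_mul_sub_le {F H : UnitAddTorus (Fin d) → ℝ}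
    (hF : IsConnectivityFunction F) (hH : IsConnectivityFunction H) {p : (Fin d → ℤ) →₀ ℂ} {η : ℝ}
    (hp : ∫ z, ‖(F z : ℂ) - p.sum fun k a => a * mFourier k z‖ ≤ η)
    (x y : UnitAddTorus (Fin d)) :
    ‖(∫ z, (F (x - z) : ℂ) * H (y - z)) -
      p.sum fun k a => a * torusFourier H (-k) * (mFourier k x * conj (mFourier k y))‖ ≤ η := by
  set P : UnitAddTorus (Fin d) → ℂ := fun z => p.sum fun k a => a * mFourier k z with hP
  have hPc : Continuous P := by
    simp only [hP, Finsupp.sum]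
    fun_prop
  have hPi : Integrable P := hPc.integrable_of_hasCompactSupport (HasCompactSupport.of_compactSpace _)
  have hHm : Measurable fun z => (H (y - z) : ℂ) :=
    Complex.measurable_ofReal.comp (hH.measurable.comp (measurable_const.sub measurable_id))
  have hHb : ∀ z, ‖(H (y - z) : ℂ)‖ ≤ 1 := fun z => by
    rw [Complex.norm_real, Real.norm_eq_abs, abs_of_nonneg (hH.nonneg _)]; exact hH.le_one _
  have hD : Integrable fun z => (F z : ℂ) - P z := hF.integrable.ofReal.sub hPi
  have hDx : Integrable fun z => (F (x - z) : ℂ) - P (x - z) := hD.comp_sub_left x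
  have hPx : Integrable fun z => P (x - z) := hPi.comp_sub_left x
  have hFx : Integrable fun z => (F (x - z) : ℂ) :=
    Integrable.comp_sub_left (f := fun z => (F z : ℂ)) hF.integrable.ofReal x
  have hterm : ∀ k, Integrable fun z => mFourier k (x - z) * (H (y - z) : ℂ) := fun k =>
    Integrable.of_bound (((ContinuousMap.measurable _).comp
      (measurable_const.sub measurable_id)).mul hHm).aestronglyMeasurable 1 (ae_of_all _ fun z => by
      rw [norm_mul, norm_mFourier_apply, one_mul]; exact hHb z)
  -- Only the factor `F` is approximated: a character integrated against `H` gives its Fourier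
  -- coefficient exactly.
  have hval : ∫ z, P (x - z) * H (y - z) =
      p.sum fun k a => a * torusFourier H (-k) * (mFourier k x * conj (mFourier k y)) := by
    simp only [hP, Finsupp.sum, Finset.sum_mul, mul_assoc]
    rw [integral_finsetSum _ fun k _ => (hterm k).const_mul _]
    refine Finset.sum_congr rfl fun k _ => ?_
    rw [integral_const_mul]
    congr 1
    have h := integral_sub_mul_mFourier H (-k) y
    calc ∫ z, mFourier k (x - z) * (H (y - z) : ℂ)
        = ∫ z, mFourier k x * ((H (y - z) : ℂ) * mFourier (-k) z) :=
          integral_congr_ae (ae_of_all _ fun z => by simp only [mFourier_sub_apply]; ring)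
      _ = _ := by rw [integral_const_mul, h, mFourier_neg]; ring
  have h1 : Integrable fun z => (F (x - z) : ℂ) * H (y - z) :=
    hFx.mul_bdd (c := 1) hHm.aestronglyMeasurable (ae_of_all _ hHb)
  have h2 : Integrable fun z => P (x - z) * H (y - z) :=
    hPx.mul_bdd (c := 1) hHm.aestronglyMeasurable (ae_of_all _ hHb)
  rw [← hval, ← integral_sub h1 h2]
  calc _ ≤ ∫ z, ‖(F (x - z) : ℂ) * H (y - z) - P (x - z) * H (y - z)‖ :=
          norm_integral_le_integral_norm _
    -- The bound `H ≤ 1` removes `y`, then translation invariance removes `x`; thus an `L¹` error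
    -- becomes a uniform one.
    _ ≤ ∫ z, ‖(F (x - z) : ℂ) - P (x - z)‖ := by
          refine integral_mono_of_nonneg (ae_of_all _ fun z => norm_nonneg _) hDx.norm
            (ae_of_all _ fun z => ?_)
          simp only
          rw [← sub_mul, norm_mul]
          exact mul_le_of_le_one_right (norm_nonneg _) (hHb z)
    _ = ∫ z, ‖(F z : ℂ) - P z‖ :=
          integral_sub_left_eq_self (fun z => ‖(F z : ℂ) - P z‖) volume x
    _ ≤ η := hp

end Fourier

/-! ### Modes, edge ownership and a general deviation bound. -/

section Concentration

open UnitAddTorus ComplexConjugate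

variable {d n : ℕ} {F_in F_out : UnitAddTorus (Fin d) → ℝ}

/-- The two characters of the label set: the constant one and the sign of the block. -/
def blockSign (b s : Fin 2) : ℝ := if b = 1 ∧ s = 1 then -1 else 1

lemma abs_blockSign (b s : Fin 2) : |blockSign b s| = 1 := by
  unfold blockSign; split_ifs <;> simp

lemma norm_blockSign (b s : Fin 2) : ‖(blockSign b s : ℂ)‖ = 1 := by
  rw [Complex.norm_real, Real.norm_eq_abs, abs_blockSign]

/-- The eigenfunction of the connectivity kernel with frequency `k` and label character `b`. -/
noncomputable def blockMode (k : Fin d → ℤ) (b : Fin 2) (x : UnitAddTorus (Fin d)) (s : Fin 2) : ℂ :=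
  mFourier k x * blockSign b s

lemma norm_blockMode (k : Fin d → ℤ) (b : Fin 2) (x : UnitAddTorus (Fin d)) (s : Fin 2) :
    ‖blockMode k b x s‖ = 1 := by
  rw [blockMode, norm_mul, norm_mFourier_apply, norm_blockSign, one_mul]

/-- The eigenvalue of the connectivity kernel for `blockMode k b`. -/
noncomputable def blockModeValue (F_in F_out : UnitAddTorus (Fin d) → ℝ) (k : Fin d → ℤ) (b : Fin 2) : ℂ :=
  (torusFourier F_in k + blockSign b 1 * torusFourier F_out k) / 2

/-- Exact balance makes label averages exact, so the labels contribute no fluctuation. -/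
lemma sum_of_mem_balancedLabellings {σ : Fin n → Fin 2} (hσ : σ ∈ balancedLabellings n)
    (f : Fin 2 → ℂ) : ∑ k, f (σ k) = n * ((f 0 + f 1) / 2) := by
  have h : ∀ s : Fin 2, ∑ k with σ k = s, f (σ k) = n / 2 * f s := by
    intro s
    rw [Finset.sum_congr rfl (g := fun _ => f s) fun k hk => by rw [(Finset.mem_filter.1 hk).2],
      Finset.sum_const, nsmul_eq_mul]
    have hs := hσ s
    have : (n : ℂ) = 2 * ((Finset.univ.filter fun k => σ k = s).card : ℂ) := by
      exact_mod_cast hs.symm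
    rw [this]; ring
  rw [← Finset.sum_fiberwise Finset.univ σ, Fin.sum_univ_two, h, h]
  ring

/-- Nodes where `p` fails own the variables of their edges to nodes where `p` holds. -/
def edgeOwner (p : Fin n → Prop) (k l : Fin n) : Prop := (p l ∧ ¬ p k) ∨ ((p k ↔ p l) ∧ k < l)

lemma edgeOwner_asymm (p : Fin n → Prop) (k l : Fin n) (h : edgeOwner p k l) :
    ¬ edgeOwner p l k := by
  unfold edgeOwner at *
  have : k < l → ¬ l < k := fun h => h.asymm
  tauto

lemma edgeOwner_total (p : Fin n → Prop) (k l : Fin n) (h : k ≠ l) :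
    edgeOwner p k l ∨ edgeOwner p l k := by
  unfold edgeOwner
  have := lt_or_gt_of_ne h
  tauto

open Classical in
lemma adjacencyMatrix_apply (G : SimpleGraph (Fin n)) (i j : Fin n) :
    adjacencyMatrix G i j = if G.Adj i j then 1 else 0 := by
  unfold adjacencyMatrix
  rw [SimpleGraph.adjMatrix_apply]

lemma adjacencyMatrix_self (G : SimpleGraph (Fin n)) (i : Fin n) : adjacencyMatrix G i i = 0 := by
  simp [adjacencyMatrix_apply]

lemma adjacencyMatrix_comm (G : SimpleGraph (Fin n)) (i j : Fin n) :
    adjacencyMatrix G i j = adjacencyMatrix G j i := by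
  classical simp only [adjacencyMatrix_apply, G.adj_comm i j]

-- A free node `k` owns its edge to a fixed node `i`, so the entry involves only the variables of
-- `k` and the position of `i`. Given the fixed nodes, such entries are independent as `k` varies.
open Classical in
lemma adjacencyMatrix_coupledGraph {p : Fin n → Prop} {σ : Fin n → Fin 2}
    {ω : Fin n → NodeSpace d n} {i k : Fin n} (hi : p i) (hk : ¬ p k) :
    adjacencyMatrix (coupledGraph (edgeOwner p) F_in F_out σ ω) k i =
      if ((ω k).2 i : ℝ) < connectivity F_in F_out ((ω k).1 - (ω i).1) (σ k) (σ i)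
        then 1 else 0 := by
  have h : edgeOwner p k i := Or.inl ⟨hi, hk⟩
  rw [adjacencyMatrix_apply]
  simp only [coupledGraph, thresholdGraph_adj_of_rel (edgeOwner_asymm p) h]
  rfl

/-- Deviation of a sum over nodes, each term depending on one free node and on the few nodes
where `p` holds. -/
lemma measure_deviation_le (p : Fin n → Prop) [DecidablePred p]
    (hcard : Fintype.card {k // p k} ≤ 2)
    {g : ({k // p k} → NodeSpace d n) → Fin n → NodeSpace d n → ℂ}
    (hg : ∀ k, Measurable fun z : _ × NodeSpace d n => g z.1 k z.2)
    (hb : ∀ y k x, ‖g y k x‖ ≤ 1) {Y : (Fin n → NodeSpace d n) → Fin n → ℂ}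
    (hY : ∀ ω k, ¬ p k → Y ω k = g (fun l => ω l) k (ω k)) (hY0 : ∀ ω k, p k → Y ω k = 0)
    {T : (Fin n → NodeSpace d n) → ℂ} {e : ℝ}
    (hT : ∀ ω : Fin n → NodeSpace d n, ‖(∑ k, ∫ x, g (fun l => ω l) k x) - T ω‖ ≤ e) {t : ℝ}
    (ht : 0 < t) :
    Measure.pi (fun _ : Fin n => (volume : Measure (NodeSpace d n)))
      {ω | t + 2 + e ≤ ‖∑ k, Y ω k - T ω‖} ≤ 4 * ENNReal.ofReal (Real.exp (-t ^ 2 / (8 * n))) := by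
  have : IsProbabilityMeasure (volume : Measure (NodeSpace d n)) := by
    rw [Measure.volume_eq_prod]; infer_instance
  refine (measure_mono fun ω hω => ?_).trans
    (measure_pi_norm_sum_ge_le_of_fixed (μ := (volume : Measure (NodeSpace d n))) p hg hb
      (N := n) (by simp) ht)
  have hω' : t + 2 + e ≤ ‖∑ k, Y ω k - T ω‖ := hω
  set M : Fin n → ℂ := fun k => ∫ x, g (fun l => ω l) k x with hM
  have hM1 : ∀ k, ‖M k‖ ≤ 1 := fun k => by
    refine (norm_integral_le_of_norm_le_const (ae_of_all _ fun x => hb _ k x)).trans ?_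
    simp
  -- The concentrating sum omits the fixed nodes, whereas `T` approximates the sum of all the means.
  -- At most two means are missing, each of norm at most 1: this is the `2` in the threshold.
  have hsplit : ∑ k, Y ω k - T ω = ∑ k : {k // ¬ p k}, (g (fun l => ω l) k (ω k) - M k) -
      ∑ k : {k // p k}, M k + (∑ k, M k - T ω) := by
    have h1 : ∑ k, Y ω k = ∑ k : {k // ¬ p k}, g (fun l => ω l) k (ω k) := by
      rw [← Fintype.sum_subtype_add_sum_subtype p,
        Finset.sum_eq_zero fun (k : {k // p k}) _ => hY0 ω k k.2, zero_add]
      exact Finset.sum_congr rfl fun (k : {k // ¬ p k}) _ => hY ω k k.2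
    rw [h1, Finset.sum_sub_distrib, ← Fintype.sum_subtype_add_sum_subtype p M]
    ring
  have hMp : ‖∑ k : {k // p k}, M k‖ ≤ 2 := by
    refine (norm_sum_le_of_le (n := fun _ => (1 : ℝ)) _ fun k _ => hM1 _).trans ?_
    simp only [Finset.sum_const, Finset.card_univ, nsmul_eq_mul, mul_one]
    exact_mod_cast hcard
  have h1 := norm_add_le (∑ k : {k // ¬ p k}, (g (fun l => ω l) k (ω k) - M k) -
      ∑ k : {k // p k}, M k) (∑ k, M k - T ω)
  have h2 := norm_sub_le (∑ k : {k // ¬ p k}, (g (fun l => ω l) k (ω k) - M k))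
    (∑ k : {k // p k}, M k)
  rw [← hsplit] at h1
  have h3 := hT ω
  simp only [Set.mem_ofPred_eq]
  linarith

lemma integral_ite_mem {α : Type*} [MeasurableSpace α] {μ : Measure α} [IsFiniteMeasure μ]
    {q : α → Prop} [DecidablePred q] (hq : MeasurableSet {x | q x}) (w : ℂ) :
    ∫ x, (if q x then w else 0) ∂μ = μ.real {x | q x} * w := by
  have : (fun x => if q x then w else 0) = {x | q x}.indicator fun _ => w := by
    ext x; simp [Set.indicator_apply]
  rw [this, integral_indicator_const _ hq, Complex.real_smul]

lemma volume_real_coord_lt {i : Fin n} {c : ℝ} (h0 : 0 ≤ c) (h1 : c ≤ 1) :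
    volume.real {u : Fin n → unitInterval | (u i : ℝ) < c} = c := by
  have hmp := measurePreserving_eval (fun _ : Fin n => (volume : Measure unitInterval)) i
  have h := hmp.measure_preimage (s := {u : unitInterval | (u : ℝ) < c})
    (measurableSet_lt measurable_subtype_coe measurable_const).nullMeasurableSet
  rw [volume_unitInterval_coe_lt h0 h1] at h
  rw [measureReal_def]
  exact (congrArg ENNReal.toReal h).trans (ENNReal.toReal_ofReal h0)

lemma volume_real_two_coord_lt {i j : Fin n} (hij : i ≠ j) {c c' : ℝ} (h0 : 0 ≤ c) (h1 : c ≤ 1)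
    (h0' : 0 ≤ c') (h1' : c' ≤ 1) :
    volume.real {u : Fin n → unitInterval | (u i : ℝ) < c ∧ (u j : ℝ) < c'} = c * c' := by
  have hset : {u : Fin n → unitInterval | (u i : ℝ) < c ∧ (u j : ℝ) < c'} =
      Set.univ.pi fun l => if l = i then {u : unitInterval | (u : ℝ) < c}
        else if l = j then {u : unitInterval | (u : ℝ) < c'} else Set.univ := by
    ext u
    simp only [Set.mem_ofPred_eq, Set.mem_pi, Set.mem_univ, true_implies]
    constructor
    · rintro ⟨hi, hj⟩ l
      split_ifs with h h'
      · rw [h]; exact hi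
      · rw [h']; exact hj
      · trivial
    · intro h
      have hi := h i
      have hj := h j
      rw [if_pos rfl] at hi
      rw [if_neg hij.symm, if_pos rfl] at hj
      exact ⟨hi, hj⟩
  rw [measureReal_def, hset, volume_pi_pi,
    Fintype.prod_eq_mul i j hij fun l hl => by rw [if_neg hl.1, if_neg hl.2, measure_univ],
    if_pos rfl, if_neg hij.symm, if_pos rfl, volume_unitInterval_coe_lt h0 h1,
    volume_unitInterval_coe_lt h0' h1', ENNReal.toReal_mul, ENNReal.toReal_ofReal h0,
    ENNReal.toReal_ofReal h0']

end Concentration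

/-! ### Concentration of rows of `A` against modes and of entries of `A²`. -/

section BlockConcentration

open UnitAddTorus ComplexConjugate

variable {d n : ℕ} {F_in F_out : UnitAddTorus (Fin d) → ℝ}

lemma connectivity_sub_comm (h_in : IsConnectivityFunction F_in)
    (h_out : IsConnectivityFunction F_out) (x z : UnitAddTorus (Fin d)) (r s : Fin 2) :
    connectivity F_in F_out (z - x) r s = (if r = s then F_in else F_out) (x - z) := by
  unfold connectivity
  rw [← neg_sub x z, h_in.neg, h_out.neg]
  split_ifs <;> rfl

lemma isConnectivityFunction_ite (h_in : IsConnectivityFunction F_in)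
    (h_out : IsConnectivityFunction F_out) (q : Prop) [Decidable q] :
    IsConnectivityFunction (if q then F_in else F_out) := by
  split_ifs
  exacts [h_in, h_out]

lemma measurableSet_coord_lt (i : Fin n) (c : ℝ) :
    MeasurableSet {u : Fin n → unitInterval | (u i : ℝ) < c} :=
  measurableSet_lt (measurable_subtype_coe.comp (measurable_pi_apply i)) measurable_const

lemma measurable_blockMode (k : Fin d → ℤ) (b s : Fin 2) :
    Measurable fun x => blockMode k b x s :=
  (ContinuousMap.measurable _).mul_const _

lemma integral_connectivity_mul_blockMode (h_in : IsConnectivityFunction F_in)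
    (h_out : IsConnectivityFunction F_out) (k : Fin d → ℤ) (b r s : Fin 2)
    (x : UnitAddTorus (Fin d)) :
    ∫ z, (connectivity F_in F_out (z - x) r s : ℂ) * blockMode k b z r =
      (if r = s then torusFourier F_in k else torusFourier F_out k) * blockMode k b x r := by
  simp_rw [connectivity_sub_comm h_in h_out x, blockMode, ← mul_assoc]
  rw [integral_mul_const, integral_sub_mul_mFourier]
  split_ifs <;> rfl

/-- The two label characters diagonalise the 2 × 2 matrix with `F̂_in` on the diagonal and `F̂_out`
off it; the factor 1/2 is the proportion of each block. -/
lemma sum_torusFourier_mul_blockMode (k : Fin d → ℤ) (b s : Fin 2) (x : UnitAddTorus (Fin d)) :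
    ((if 0 = s then torusFourier F_in k else torusFourier F_out k) * blockMode k b x 0 +
      (if 1 = s then torusFourier F_in k else torusFourier F_out k) * blockMode k b x 1) / 2 =
      blockModeValue F_in F_out k b * blockMode k b x s := by
  unfold blockMode blockModeValue blockSign
  fin_cases b <;> fin_cases s <;> simp <;> ring

/-- The modes are approximate eigenvectors of the adjacency matrix. -/
lemma measure_blockMode_deviation_le (h_in : IsConnectivityFunction F_in)
    (h_out : IsConnectivityFunction F_out) {σ : Fin n → Fin 2} (hσ : σ ∈ balancedLabellings n)
    (i : Fin n) (κ : Fin d → ℤ) (b : Fin 2) {t : ℝ} (ht : 0 < t) :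
    Measure.pi (fun _ : Fin n => (volume : Measure (NodeSpace d n)))
      {ω | t + 2 ≤ ‖∑ j, (adjacencyMatrix
          (coupledGraph (edgeOwner (· = i)) F_in F_out σ ω) i j : ℂ) * blockMode κ b (ω j).1 (σ j) -
        n * blockModeValue F_in F_out κ b * blockMode κ b (ω i).1 (σ i)‖} ≤
      4 * ENNReal.ofReal (Real.exp (-t ^ 2 / (8 * n))) := by
  classical
  have hset : ∀ k, MeasurableSet {z : ({k // k = i} → NodeSpace d n) × NodeSpace d n |
      (z.2.2 i : ℝ) < connectivity F_in F_out (z.2.1 - (z.1 ⟨i, rfl⟩).1) (σ k) (σ i)} := by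
    intro k
    refine measurableSet_lt (measurable_subtype_coe.comp
      ((measurable_pi_apply i).comp (measurable_snd.comp measurable_snd))) ?_
    exact (measurable_connectivity h_in h_out _ _).comp ((measurable_fst.comp measurable_snd).sub
      (measurable_fst.comp ((measurable_pi_apply _).comp measurable_fst)))
  have hmeas : ∀ k, Measurable fun z : ({k // k = i} → NodeSpace d n) × NodeSpace d n =>
      if (z.2.2 i : ℝ) < connectivity F_in F_out (z.2.1 - (z.1 ⟨i, rfl⟩).1) (σ k) (σ i)
      then blockMode κ b z.2.1 (σ k) else 0 := fun k =>
    Measurable.ite (hset k) ((measurable_blockMode κ b (σ k)).comp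
      (measurable_fst.comp measurable_snd)) measurable_const
  have hbound : ∀ (y : {k // k = i} → NodeSpace d n) (k : Fin n) (x : NodeSpace d n),
      ‖if (x.2 i : ℝ) < connectivity F_in F_out (x.1 - (y ⟨i, rfl⟩).1) (σ k) (σ i)
      then blockMode κ b x.1 (σ k) else 0‖ ≤ 1 := by
    intro y k x
    split_ifs
    · rw [norm_blockMode]
    · simp
  have h := measure_deviation_le (· = i) (by simp)
    (g := fun y k x =>
      if (x.2 i : ℝ) < connectivity F_in F_out (x.1 - (y ⟨i, rfl⟩).1) (σ k) (σ i)
      then blockMode κ b x.1 (σ k) else 0) hmeas hbound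
    (Y := fun ω j => (adjacencyMatrix
      (coupledGraph (edgeOwner (· = i)) F_in F_out σ ω) i j : ℂ) * blockMode κ b (ω j).1 (σ j))
    (T := fun ω => n * blockModeValue F_in F_out κ b * blockMode κ b (ω i).1 (σ i)) (e := 0)
    (fun ω k hk => ?_) (fun ω k hk => ?_) (fun ω => ?_) ht
  · simpa only [add_zero] using h
  · rw [adjacencyMatrix_comm, adjacencyMatrix_coupledGraph (p := (· = i)) rfl hk]
    split_ifs <;> simp
  · rw [hk, adjacencyMatrix_self]
    simp
  · refine le_of_eq (norm_eq_zero.2 (sub_eq_zero.2 ?_))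
    set f : Fin 2 → ℂ := fun r =>
      (if r = σ i then torusFourier F_in κ else torusFourier F_out κ) *
        blockMode κ b (ω i).1 r with hf
    -- Averaging over the uniform variable gives the connection probability, then over the position
    -- a convolution with a character. The means therefore sum to `T` exactly, whence `e = 0`.
    have hmean : ∀ k, ∫ x : NodeSpace d n,
        (if (x.2 i : ℝ) < connectivity F_in F_out (x.1 - (ω i).1) (σ k) (σ i)
          then blockMode κ b x.1 (σ k) else 0) =
        f (σ k) := by
      intro k
      rw [Measure.volume_eq_prod, integral_prod]
      · simp only [hf]
        rw [← integral_connectivity_mul_blockMode h_in h_out]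
        refine integral_congr_ae (ae_of_all _ fun z => ?_)
        dsimp only
        rw [integral_ite_mem (q := fun u : Fin n → unitInterval =>
            (u i : ℝ) < connectivity F_in F_out (z - (ω i).1) (σ k) (σ i))
          (measurableSet_coord_lt i _),
          volume_real_coord_lt (connectivity_mem h_in h_out _ _ _).1
            (connectivity_mem h_in h_out _ _ _).2]
      · exact Integrable.of_bound ((hmeas k).comp
          (measurable_prodMk_left (x := fun l : {k // k = i} => ω l))).aestronglyMeasurable 1
          (ae_of_all _ fun x => hbound (fun l => ω l) k x)
    dsimp only
    rw [Finset.sum_congr rfl fun k _ => hmean k, sum_of_mem_balancedLabellings hσ,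
      sum_torusFourier_mul_blockMode, mul_assoc]

/-- Coefficients of the two-step kernel on the modes, given Fourier coefficients `p_in`, `p_out`
of trigonometric approximations of the connectivity functions. -/
noncomputable def blockCoefficient (F_in F_out : UnitAddTorus (Fin d) → ℝ)
    (p_in p_out : (Fin d → ℤ) →₀ ℂ) (k : Fin d → ℤ) (b : Fin 2) : ℂ :=
  ((p_in k * torusFourier F_in (-k) + p_out k * torusFourier F_out (-k)) / 2 +
    blockSign b 1 *
      ((p_in k * torusFourier F_out (-k) + p_out k * torusFourier F_in (-k)) / 2)) / 2

/-- The two-step kernel, summed over the intermediate label, depends on `s` and `s'` only through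
whether they agree, so the label characters diagonalise it as well. -/
lemma sum_blockCoefficient_mul (p_in p_out : (Fin d → ℤ) →₀ ℂ) (k : Fin d → ℤ) (s s' : Fin 2)
    (x y : UnitAddTorus (Fin d)) :
    ∑ b, blockCoefficient F_in F_out p_in p_out k b * blockMode k b x s *
      conj (blockMode k b y s') =
      ((if 0 = s then p_in else p_out) k *
          torusFourier (if 0 = s' then F_in else F_out) (-k) *
          (mFourier k x * conj (mFourier k y)) +
        (if 1 = s then p_in else p_out) k *
          torusFourier (if 1 = s' then F_in else F_out) (-k) *
          (mFourier k x * conj (mFourier k y))) / 2 := by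
  unfold blockCoefficient blockMode blockSign
  rw [Fin.sum_univ_two]
  fin_cases s <;> fin_cases s' <;> simp <;> ring

/-- The square of the adjacency matrix is entrywise close to a low rank matrix of modes. -/
lemma measure_square_deviation_le (h_in : IsConnectivityFunction F_in)
    (h_out : IsConnectivityFunction F_out) {p_in p_out : (Fin d → ℤ) →₀ ℂ} {η : ℝ}
    (hp_in : ∫ z, ‖(F_in z : ℂ) - p_in.sum fun k a => a * mFourier k z‖ ≤ η)
    (hp_out : ∫ z, ‖(F_out z : ℂ) - p_out.sum fun k a => a * mFourier k z‖ ≤ η)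
    {S : Finset (Fin d → ℤ)} (hS_in : p_in.support ⊆ S) (hS_out : p_out.support ⊆ S)
    {σ : Fin n → Fin 2} (hσ : σ ∈ balancedLabellings n) {i j : Fin n} (hij : i ≠ j)
    {t : ℝ} (ht : 0 < t) :
    Measure.pi (fun _ : Fin n => (volume : Measure (NodeSpace d n)))
      {ω | t + 2 + n * η ≤ ‖((adjacencyMatrix (coupledGraph (edgeOwner fun k => k = i ∨ k = j)
          F_in F_out σ ω) * adjacencyMatrix (coupledGraph (edgeOwner fun k => k = i ∨ k = j)
          F_in F_out σ ω)) i j : ℂ) - n * ∑ κ : S × Fin 2,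
          blockCoefficient F_in F_out p_in p_out κ.1 κ.2 * blockMode κ.1 κ.2 (ω i).1 (σ i) *
            conj (blockMode κ.1 κ.2 (ω j).1 (σ j))‖} ≤
      4 * ENNReal.ofReal (Real.exp (-t ^ 2 / (8 * n))) := by
  classical
  set p : Fin n → Prop := fun k => k = i ∨ k = j with hp
  have hpi : p i := Or.inl rfl
  have hpj : p j := Or.inr rfl
  have hset1 : ∀ (k l : Fin n) (hl : p l),
      MeasurableSet {z : ({k // p k} → NodeSpace d n) × NodeSpace d n |
      (z.2.2 l : ℝ) < connectivity F_in F_out (z.2.1 - (z.1 ⟨l, hl⟩).1) (σ k) (σ l)} := by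
    intro k l hl
    refine measurableSet_lt (measurable_subtype_coe.comp
      ((measurable_pi_apply l).comp (measurable_snd.comp measurable_snd))) ?_
    exact (measurable_connectivity h_in h_out _ _).comp ((measurable_fst.comp measurable_snd).sub
      (measurable_fst.comp ((measurable_pi_apply _).comp measurable_fst)))
  have hmeas : ∀ k, Measurable fun z : ({k // p k} → NodeSpace d n) × NodeSpace d n =>
      if (z.2.2 i : ℝ) < connectivity F_in F_out (z.2.1 - (z.1 ⟨i, hpi⟩).1) (σ k) (σ i) ∧
        (z.2.2 j : ℝ) < connectivity F_in F_out (z.2.1 - (z.1 ⟨j, hpj⟩).1) (σ k) (σ j)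
      then (1 : ℂ) else 0 := fun k =>
    Measurable.ite ((hset1 k i hpi).inter (hset1 k j hpj)) measurable_const measurable_const
  have hbound : ∀ (y : {k // p k} → NodeSpace d n) (k : Fin n) (x : NodeSpace d n),
      ‖if (x.2 i : ℝ) < connectivity F_in F_out (x.1 - (y ⟨i, hpi⟩).1) (σ k) (σ i) ∧
        (x.2 j : ℝ) < connectivity F_in F_out (x.1 - (y ⟨j, hpj⟩).1) (σ k) (σ j)
      then (1 : ℂ) else 0‖ ≤ 1 := by
    intro y k x
    split_ifs <;> simp
  have hcard : Fintype.card {k // p k} ≤ 2 := by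
    rw [Fintype.card_subtype]
    refine (Finset.card_le_card (t := {i, j}) fun k hk => ?_).trans Finset.card_le_two
    simpa [hp] using hk
  have h := measure_deviation_le p hcard
    (g := fun y k x =>
      if (x.2 i : ℝ) < connectivity F_in F_out (x.1 - (y ⟨i, hpi⟩).1) (σ k) (σ i) ∧
        (x.2 j : ℝ) < connectivity F_in F_out (x.1 - (y ⟨j, hpj⟩).1) (σ k) (σ j)
      then (1 : ℂ) else 0) hmeas hbound
    (Y := fun ω k => (adjacencyMatrix (coupledGraph (edgeOwner p) F_in F_out σ ω) i k : ℂ) *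
      adjacencyMatrix (coupledGraph (edgeOwner p) F_in F_out σ ω) k j)
    (T := fun ω => n * ∑ κ : S × Fin 2,
          blockCoefficient F_in F_out p_in p_out κ.1 κ.2 * blockMode κ.1 κ.2 (ω i).1 (σ i) *
            conj (blockMode κ.1 κ.2 (ω j).1 (σ j))) (e := n * η)
    (fun ω k hk => ?_) (fun ω k hk => ?_) (fun ω => ?_) ht
  · simpa only [Matrix.mul_apply, Complex.ofReal_sum, Complex.ofReal_mul] using h
  · rw [adjacencyMatrix_comm _ i k, adjacencyMatrix_coupledGraph hpi hk,
      adjacencyMatrix_coupledGraph hpj hk, ite_and]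
    split_ifs <;> simp
  · rcases hk with rfl | rfl <;> simp [adjacencyMatrix_self]
  -- Given its position, a node joins `i` and `j` independently; so the probability that a node of
  -- label `r` is a common neighbour is a convolution.
  · set f : Fin 2 → ℂ := fun r => ∫ z,
      ((if r = σ i then F_in else F_out) ((ω i).1 - z) : ℂ) *
        (if r = σ j then F_in else F_out) ((ω j).1 - z) with hf
    have hmean : ∀ k, ∫ x : NodeSpace d n,
        (if (x.2 i : ℝ) < connectivity F_in F_out (x.1 - (ω i).1) (σ k) (σ i) ∧
          (x.2 j : ℝ) < connectivity F_in F_out (x.1 - (ω j).1) (σ k) (σ j)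
          then (1 : ℂ) else 0) = f (σ k) := by
      intro k
      rw [Measure.volume_eq_prod, integral_prod]
      · refine integral_congr_ae (ae_of_all _ fun z => ?_)
        dsimp only
        rw [integral_ite_mem (q := fun u : Fin n → unitInterval =>
            (u i : ℝ) < connectivity F_in F_out (z - (ω i).1) (σ k) (σ i) ∧
            (u j : ℝ) < connectivity F_in F_out (z - (ω j).1) (σ k) (σ j))
          ((measurableSet_coord_lt i _).inter (measurableSet_coord_lt j _)),
          volume_real_two_coord_lt hij (connectivity_mem h_in h_out _ _ _).1
            (connectivity_mem h_in h_out _ _ _).2 (connectivity_mem h_in h_out _ _ _).1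
            (connectivity_mem h_in h_out _ _ _).2, mul_one,
          connectivity_sub_comm h_in h_out, connectivity_sub_comm h_in h_out, Complex.ofReal_mul]
      · exact Integrable.of_bound ((hmeas k).comp
          (measurable_prodMk_left (x := fun l : {k // p k} => ω l))).aestronglyMeasurable 1
          (ae_of_all _ fun x => hbound (fun l => ω l) k x)
    dsimp only
    rw [Finset.sum_congr rfl fun k _ => hmean k, sum_of_mem_balancedLabellings hσ, ← mul_sub,
      norm_mul, Complex.norm_natCast]
    refine mul_le_mul_of_nonneg_left ?_ (by positivity)
    have happ : ∀ r : Fin 2, ‖f r - ∑ k ∈ S, (if r = σ i then p_in else p_out) k *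
        torusFourier (if r = σ j then F_in else F_out) (-k) *
          (mFourier k (ω i).1 * conj (mFourier k (ω j).1))‖ ≤ η := by
      intro r
      have hS : (if r = σ i then p_in else p_out).support ⊆ S := by split_ifs <;> assumption
      have := norm_integral_sub_mul_sub_le (η := η) (p := if r = σ i then p_in else p_out)
        (isConnectivityFunction_ite h_in h_out (r = σ i))
        (isConnectivityFunction_ite h_in h_out (r = σ j)) (by split_ifs <;> assumption)
        (ω i).1 (ω j).1
      rwa [Finsupp.sum_of_support_subset _ hS _ (by simp)] at this
    have hsum : ∑ κ : S × Fin 2,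
          blockCoefficient F_in F_out p_in p_out κ.1 κ.2 * blockMode κ.1 κ.2 (ω i).1 (σ i) *
            conj (blockMode κ.1 κ.2 (ω j).1 (σ j)) =
        (∑ k ∈ S, (if 0 = σ i then p_in else p_out) k *
            torusFourier (if 0 = σ j then F_in else F_out) (-k) *
            (mFourier k (ω i).1 * conj (mFourier k (ω j).1)) +
          ∑ k ∈ S, (if 1 = σ i then p_in else p_out) k *
            torusFourier (if 1 = σ j then F_in else F_out) (-k) *
            (mFourier k (ω i).1 * conj (mFourier k (ω j).1))) / 2 := by
      rw [Fintype.sum_prod_type]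
      simp_rw [sum_blockCoefficient_mul]
      rw [Finset.sum_coe_sort S fun k => ((if 0 = σ i then p_in else p_out) k *
          torusFourier (if 0 = σ j then F_in else F_out) (-k) *
          (mFourier k (ω i).1 * conj (mFourier k (ω j).1)) +
        (if 1 = σ i then p_in else p_out) k *
          torusFourier (if 1 = σ j then F_in else F_out) (-k) *
          (mFourier k (ω i).1 * conj (mFourier k (ω j).1))) / 2,
        ← Finset.sum_div, Finset.sum_add_distrib]
    rw [hsum, ← sub_div, add_sub_add_comm, norm_div, Complex.norm_ofNat, div_le_iff₀ two_pos]
    exact (norm_add_le _ _).trans ((add_le_add (happ 0) (happ 1)).trans (le_of_eq (by ring)))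

end BlockConcentration

/-! ### Union bound and choice of constants. -/

section SpectralGap

open UnitAddTorus ComplexConjugate

variable {d n : ℕ} {F_in F_out : UnitAddTorus (Fin d) → ℝ}

/-- Distance of a mode from being an eigenvector of the adjacency matrix, at row `i`. -/
noncomputable def modeDeviation (F_in F_out : UnitAddTorus (Fin d) → ℝ) (κ : Fin d → ℤ) (b : Fin 2)
    (i : Fin n) (z : (Fin n → Fin 2) × (Fin n → UnitAddTorus (Fin d)) × SimpleGraph (Fin n)) : ℝ :=
  ‖∑ j, (adjacencyMatrix z.2.2 i j : ℂ) * blockMode κ b (z.2.1 j) (z.1 j) -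
    n * blockModeValue F_in F_out κ b * blockMode κ b (z.2.1 i) (z.1 i)‖

/-- Distance of the squared adjacency matrix from a combination of modes, at the entry `i, j`. -/
noncomputable def squareDeviation (c : (Fin d → ℤ) → Fin 2 → ℂ) (S : Finset (Fin d → ℤ))
    (i j : Fin n)
    (z : (Fin n → Fin 2) × (Fin n → UnitAddTorus (Fin d)) × SimpleGraph (Fin n)) : ℝ :=
  ‖((adjacencyMatrix z.2.2 * adjacencyMatrix z.2.2) i j : ℂ) - n * ∑ κ : S × Fin 2,
    c κ.1 κ.2 * blockMode κ.1 κ.2 (z.2.1 i) (z.1 i) * conj (blockMode κ.1 κ.2 (z.2.1 j) (z.1 j))‖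

lemma measurable_blockMode_apply (κ : Fin d → ℤ) (b : Fin 2) (σ : Fin n → Fin 2) (j : Fin n) :
    Measurable fun X : Fin n → UnitAddTorus (Fin d) => blockMode κ b (X j) (σ j) :=
  (measurable_blockMode κ b (σ j)).comp (measurable_pi_apply j)

lemma measurable_modeDeviation (κ : Fin d → ℤ) (b : Fin 2) (i : Fin n) :
    Measurable (modeDeviation F_in F_out κ b i) := by
  refine measurable_from_prod_countable_right fun σ => ?_
  refine measurable_from_prod_countable_left fun G => ?_
  have h := measurable_blockMode_apply κ b σ
  refine Measurable.norm (Measurable.sub (Finset.measurable_sum _ fun j _ => ?_) ?_)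
  · exact (h j).const_mul (adjacencyMatrix G i j : ℂ)
  · exact (h i).const_mul (n * blockModeValue F_in F_out κ b)

lemma measurable_squareDeviation (c : (Fin d → ℤ) → Fin 2 → ℂ) (S : Finset (Fin d → ℤ))
    (i j : Fin n) : Measurable (squareDeviation c S i j) := by
  refine measurable_from_prod_countable_right fun σ => ?_
  refine measurable_from_prod_countable_left fun G => ?_
  have h := fun κ : S × Fin 2 => measurable_blockMode_apply κ.1.1 κ.2 σ
  have key : ∀ a : ℂ, Measurable fun X : Fin n → UnitAddTorus (Fin d) =>
      ‖a - n * ∑ κ : S × Fin 2, c κ.1 κ.2 * blockMode κ.1 κ.2 (X i) (σ i) *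
        conj (blockMode κ.1 κ.2 (X j) (σ j))‖ := fun a => by
    refine Measurable.norm (Measurable.sub measurable_const
      (Measurable.const_mul (Finset.measurable_sum _ fun κ _ => ?_) _))
    exact Measurable.mul ((h κ i).const_mul _) (Complex.continuous_conj.measurable.comp (h κ j))
  exact key ((adjacencyMatrix G * adjacencyMatrix G) i j : ℝ)

/-- Each row `i` uses its own coupling of the same law, in which every other node owns its edge to
`i`. -/
lemma sgbmLaw_modeDeviation_le (h_in : IsConnectivityFunction F_in)
    (h_out : IsConnectivityFunction F_out) (κ : Fin d → ℤ) (b : Fin 2) (i : Fin n)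
    {t : ℝ} (ht : 0 < t) :
    sgbmLaw n F_in F_out {z | t + 2 ≤ modeDeviation F_in F_out κ b i z} ≤
      4 * ENNReal.ofReal (Real.exp (-t ^ 2 / (8 * n))) :=
  sgbmLaw_le_of_forall_balanced h_in h_out (edgeOwner_asymm (· = i)) (edgeOwner_total (· = i))
    (measurableSet_le measurable_const (measurable_modeDeviation κ b i))
    fun _ hσ => measure_blockMode_deviation_le h_in h_out hσ i κ b ht

lemma sgbmLaw_squareDeviation_le (h_in : IsConnectivityFunction F_in)
    (h_out : IsConnectivityFunction F_out) {p_in p_out : (Fin d → ℤ) →₀ ℂ} {η : ℝ}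
    (hp_in : ∫ z, ‖(F_in z : ℂ) - p_in.sum fun k a => a * mFourier k z‖ ≤ η)
    (hp_out : ∫ z, ‖(F_out z : ℂ) - p_out.sum fun k a => a * mFourier k z‖ ≤ η)
    {S : Finset (Fin d → ℤ)} (hS_in : p_in.support ⊆ S) (hS_out : p_out.support ⊆ S)
    {i j : Fin n} (hij : i ≠ j) {t : ℝ} (ht : 0 < t) :
    sgbmLaw n F_in F_out {z | t + 2 + n * η ≤
        squareDeviation (blockCoefficient F_in F_out p_in p_out) S i j z} ≤
      4 * ENNReal.ofReal (Real.exp (-t ^ 2 / (8 * n))) :=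
  sgbmLaw_le_of_forall_balanced h_in h_out (edgeOwner_asymm fun k => k = i ∨ k = j)
    (edgeOwner_total fun k => k = i ∨ k = j)
    (measurableSet_le measurable_const (measurable_squareDeviation _ S i j))
    fun _ hσ => measure_square_deviation_le h_in h_out hp_in hp_out hS_in hS_out hσ hij ht

/-- The graphs for which some mode is not an approximate eigenvector, or the squared adjacency
matrix is not close to the combination of modes. -/
def deviationEvent (n : ℕ) (F_in F_out : UnitAddTorus (Fin d) → ℝ)
    (c : (Fin d → ℤ) → Fin 2 → ℂ) (S : Finset (Fin d → ℤ)) (δ η : ℝ) :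
    Set ((Fin n → Fin 2) × (Fin n → UnitAddTorus (Fin d)) × SimpleGraph (Fin n)) :=
  (⋃ i : Fin n, ⋃ κ : S × Fin 2, {z | δ * n ≤ modeDeviation F_in F_out κ.1 κ.2 i z}) ∪
    ⋃ i : Fin n, ⋃ j : Fin n, {z | i ≠ j ∧ η * n ≤ squareDeviation c S i j z}

lemma measurableSet_deviationEvent (c : (Fin d → ℤ) → Fin 2 → ℂ) (S : Finset (Fin d → ℤ))
    (δ η : ℝ) : MeasurableSet (deviationEvent n F_in F_out c S δ η) :=
  (MeasurableSet.iUnion fun i => MeasurableSet.iUnion fun _ =>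
    measurableSet_le measurable_const (measurable_modeDeviation _ _ i)).union
  (MeasurableSet.iUnion fun i => MeasurableSet.iUnion fun j =>
    (MeasurableSet.const _).inter
      (measurableSet_le measurable_const (measurable_squareDeviation c S i j)))

/-- Deviation events are exponentially unlikely. -/
lemma sgbmLaw_deviationEvent_le (h_in : IsConnectivityFunction F_in)
    (h_out : IsConnectivityFunction F_out) {p_in p_out : (Fin d → ℤ) →₀ ℂ} {δ η : ℝ}
    (hδ : 0 < δ) (hη : 0 < η)
    (hp_in : ∫ z, ‖(F_in z : ℂ) - p_in.sum fun k a => a * mFourier k z‖ ≤ η / 3)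
    (hp_out : ∫ z, ‖(F_out z : ℂ) - p_out.sum fun k a => a * mFourier k z‖ ≤ η / 3)
    {S : Finset (Fin d → ℤ)} (hS_in : p_in.support ⊆ S) (hS_out : p_out.support ⊆ S)
    (hnδ : 4 ≤ δ * n) (hnη : 6 ≤ η * n) :
    sgbmLaw n F_in F_out
        (deviationEvent n F_in F_out (blockCoefficient F_in F_out p_in p_out) S δ η) ≤
      ENNReal.ofReal (4 * (2 * S.card + 1) *
        (n ^ 2 * Real.exp (-(min (δ ^ 2 / 32) (η ^ 2 / 72)) * n))) := by
  have hn : (0 : ℝ) < n := by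
    by_contra! h
    nlinarith
  have hn1 : (1 : ℝ) ≤ n := by
    have : 0 < n := by exact_mod_cast hn
    exact_mod_cast this
  -- The rates come from `t = δ / 2 * n` and `t = η / 3 * n` in `t ^ 2 / (8 * n)`. What is left of
  -- `δ * n`, and of `η * n` after the approximation error `η / 3 * n`, is at least 2 by `hnδ` and
  -- `hnη`, which covers the fixed nodes.
  set a := min (δ ^ 2 / 32) (η ^ 2 / 72) with ha
  have hexp : ∀ s : ℝ, a ≤ s ^ 2 / 8 →
      ENNReal.ofReal (Real.exp (-(s * n) ^ 2 / (8 * n))) ≤ ENNReal.ofReal (Real.exp (-a * n)) := by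
    intro s hs
    refine ENNReal.ofReal_le_ofReal (Real.exp_le_exp.2 ?_)
    have : -(s * n) ^ 2 / (8 * n) = -(s ^ 2 / 8) * n := by field_simp
    rw [this]
    exact mul_le_mul_of_nonneg_right (neg_le_neg hs) hn.le
  set u := 4 * ENNReal.ofReal (Real.exp (-a * n)) with hu
  have h1 : ∀ (i : Fin n) (κ : S × Fin 2),
      sgbmLaw n F_in F_out {z | δ * n ≤ modeDeviation F_in F_out κ.1 κ.2 i z} ≤ u := by
    intro i κ
    refine (measure_mono fun z hz => ?_).trans
      ((sgbmLaw_modeDeviation_le h_in h_out κ.1 κ.2 i (t := δ / 2 * n) (by positivity)).trans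
        (mul_le_mul_right (hexp (δ / 2) ?_) _))
    · have hz' : δ * n ≤ modeDeviation F_in F_out κ.1 κ.2 i z := hz
      simp only [Set.mem_ofPred_eq]
      linarith
    · exact (min_le_left _ _).trans (le_of_eq (by ring))
  have h2 : ∀ i j : Fin n, sgbmLaw n F_in F_out {z | i ≠ j ∧ η * n ≤
      squareDeviation (blockCoefficient F_in F_out p_in p_out) S i j z} ≤ u := by
    intro i j
    by_cases hij : i = j
    · simp [hij]
    refine (measure_mono fun z hz => ?_).trans
      ((sgbmLaw_squareDeviation_le h_in h_out hp_in hp_out hS_in hS_out hij (t := η / 3 * n)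
        (by positivity)).trans (mul_le_mul_right (hexp (η / 3) ?_) _))
    · have hz' : η * n ≤ squareDeviation (blockCoefficient F_in F_out p_in p_out) S i j z := hz.2
      simp only [Set.mem_ofPred_eq]
      linarith
    · exact (min_le_right _ _).trans (le_of_eq (by ring))
  have hbound : sgbmLaw n F_in F_out
      (deviationEvent n F_in F_out (blockCoefficient F_in F_out p_in p_out) S δ η) ≤
      n * ((2 * S.card : ℕ) * u) + n * (n * u) := by
    refine (measure_union_le _ _).trans (add_le_add ?_ ?_)
    · refine (measure_iUnion_fintype_le _ _).trans ((Finset.sum_le_sum fun i _ =>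
        (measure_iUnion_fintype_le _ _).trans (Finset.sum_le_sum fun κ _ => h1 i κ)).trans ?_)
      simp [mul_comm]
    · refine (measure_iUnion_fintype_le _ _).trans ((Finset.sum_le_sum fun i _ =>
        (measure_iUnion_fintype_le _ _).trans (Finset.sum_le_sum fun j _ => h2 i j)).trans ?_)
      simp
  refine hbound.trans ?_
  have hu' : u = ENNReal.ofReal (4 * Real.exp (-a * n)) := by
    rw [hu, ENNReal.ofReal_mul (by norm_num)]; simp
  rw [hu', ← ENNReal.ofReal_natCast n, ← ENNReal.ofReal_natCast (2 * S.card),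
    ← ENNReal.ofReal_mul (by positivity), ← ENNReal.ofReal_mul (by positivity),
    ← ENNReal.ofReal_mul (by positivity), ← ENNReal.ofReal_mul (by positivity),
    ← ENNReal.ofReal_add (by positivity) (by positivity)]
  refine ENNReal.ofReal_le_ofReal ?_
  push_cast
  have he := Real.exp_pos (-a * n)
  have hS0 : (0 : ℝ) ≤ S.card := by positivity
  have key : (n : ℝ) * (2 * S.card) ≤ n ^ 2 * (2 * S.card) := by
    refine mul_le_mul_of_nonneg_right ?_ (by positivity)
    nlinarith
  nlinarith [mul_le_mul_of_nonneg_right key he.le]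

/-- Twice the value of a mode is the sum (`b = 0`) or the difference (`b = 1`) of the Fourier
coefficients, so the two non-resonance conditions exclude every mode but the sign vector. -/
lemma blockModeValue_ne (hsum : ∀ k : Fin d → ℤ, torusFourier F_in k + torusFourier F_out k ≠
      ((edgeDensity F_in - edgeDensity F_out : ℝ) : ℂ))
    (hdiff : ∀ k : Fin d → ℤ, k ≠ 0 → torusFourier F_in k - torusFourier F_out k ≠
      ((edgeDensity F_in - edgeDensity F_out : ℝ) : ℂ)) {k : Fin d → ℤ} {b : Fin 2}
    (h : ¬ (k = 0 ∧ b = 1)) :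
    blockModeValue F_in F_out k b ≠ (((edgeDensity F_in - edgeDensity F_out) / 2 : ℝ) : ℂ) := by
  intro heq
  rw [Complex.ofReal_div, Complex.ofReal_ofNat, blockModeValue,
    div_left_inj' two_ne_zero] at heq
  by_cases hb : b = 1
  · refine hdiff k (fun hk => h ⟨hk, hb⟩) ?_
    rw [← heq, hb]
    simp [blockSign, sub_eq_add_neg]
  · refine hsum k ?_
    rw [← heq]
    simp [blockSign, hb]

lemma exists_pos_forall_le_of_finite {K : Type*} [Finite K] {q : K → Prop} {f : K → ℝ}
    (hf : ∀ κ, q κ → 0 < f κ) : ∃ γ : ℝ, 0 < γ ∧ ∀ κ, q κ → γ ≤ f κ := by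
  have h : ∀ᶠ γ in nhdsWithin (0 : ℝ) (Set.Ioi 0), ∀ κ, q κ → γ ≤ f κ := by
    refine eventually_all.2 fun κ => ?_
    by_cases hκ : q κ
    · filter_upwards [Ioo_mem_nhdsGT (hf κ hκ)] with γ hγ _ using hγ.2.le
    · exact Eventually.of_forall fun _ h => absurd h hκ
  obtain ⟨γ, hγ, hγ0⟩ := (h.and self_mem_nhdsWithin).exists
  exact ⟨γ, hγ0, hγ⟩

/-- Outside events of exponentially small probability, the adjacency matrix of a large block model
graph has a simple isolated eigenvalue near the ideal value. -/
theorem exists_event_isolated_eigenvalue (h_in : IsConnectivityFunction F_in)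
    (h_out : IsConnectivityFunction F_out) (hne : edgeDensity F_in ≠ edgeDensity F_out)
    (hsum : ∀ k : Fin d → ℤ, torusFourier F_in k + torusFourier F_out k ≠
      ((edgeDensity F_in - edgeDensity F_out : ℝ) : ℂ))
    (hdiff : ∀ k : Fin d → ℤ, k ≠ 0 → torusFourier F_in k - torusFourier F_out k ≠
      ((edgeDensity F_in - edgeDensity F_out : ℝ) : ℂ)) :
    ∃ ε a C : ℝ, 0 < ε ∧ 0 < a ∧ 0 ≤ C ∧ 
      ∃ B : ∀ n, Set ((Fin n → Fin 2) × (Fin n → UnitAddTorus (Fin d)) × SimpleGraph (Fin n)),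
      ∃ N : ℕ, ∀ n ≥ N, MeasurableSet (B n) ∧
        sgbmLaw n F_in F_out (B n) ≤ ENNReal.ofReal (C * (n ^ 2 * Real.exp (-a * n))) ∧
        ∀ σ X G, (σ, X, G) ∉ B n → ∃ t : ℝ, IsEigenvalue (adjacencyMatrix G) t ∧
          eigenvalueMultiplicity (adjacencyMatrix G) t = 1 ∧
          ∀ s : ℝ, IsEigenvalue (adjacencyMatrix G) s → s ≠ t →
            |t - idealValue n F_in F_out| < |s - idealValue n F_in F_out| ∧
            ε * n ≤ |s - t| ∧ ε * n ≤ |s - idealValue n F_in F_out| := by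
  classical
  set θ₀ : ℝ := (edgeDensity F_in - edgeDensity F_out) / 2 with hθ₀
  have hθ0 : θ₀ ≠ 0 := div_ne_zero (sub_ne_zero.2 hne) two_ne_zero
  -- The choices are not circular: `η` depends on `θ₀` alone, then the polynomials fix `S`, `C` and
  -- `γ`, and `δ` comes last.
  set η : ℝ := θ₀ ^ 2 / 16 with hη
  have hη0 : 0 < η := by positivity
  obtain ⟨p_in, hp_in⟩ := exists_trigonometric_approx h_in.integrable.ofReal
    (show 0 < η / 3 by positivity)
  obtain ⟨p_out, hp_out⟩ := exists_trigonometric_approx h_out.integrable.ofReal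
    (show 0 < η / 3 by positivity)
  -- Frequency 0 is added so that the sign vector is always among the modes.
  set S : Finset (Fin d → ℤ) := insert 0 (p_in.support ∪ p_out.support) with hS
  have hS_in : p_in.support ⊆ S :=
    Finset.subset_union_left.trans (Finset.subset_insert _ _)
  have hS_out : p_out.support ⊆ S :=
    Finset.subset_union_right.trans (Finset.subset_insert _ _)
  set κ₀ : S × Fin 2 := (⟨0, Finset.mem_insert_self _ _⟩, 1) with hκ₀
  set θ : S × Fin 2 → ℂ := fun κ => blockModeValue F_in F_out κ.1 κ.2 with hθ
  set c : S × Fin 2 → ℂ := fun κ => blockCoefficient F_in F_out p_in p_out κ.1 κ.2 with hc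
  set C : ℝ := ∑ κ, ‖c κ‖ with hC
  have hC0 : 0 ≤ C := Finset.sum_nonneg fun _ _ => norm_nonneg _
  obtain ⟨γ, hγ0, hγ⟩ := exists_pos_forall_le_of_finite (q := fun κ : S × Fin 2 => κ ≠ κ₀)
    (f := fun κ => ‖θ κ - θ₀‖) fun κ hκ => norm_pos_iff.2 (sub_ne_zero.2
      (blockModeValue_ne hsum hdiff fun h => hκ (Prod.ext (Subtype.ext h.1) h.2)))
  -- With `ε = 3 * δ` in the criterion, the first term gives `ε ≤ |θ₀| / 2` and the second bounds `C
  -- * (4 * δ / γ)` by `θ₀ ^ 2 / 16`; `C + 1` avoids dividing by zero.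
  set δ : ℝ := min (|θ₀| / 6) (θ₀ ^ 2 * γ / (64 * (C + 1))) with hδ
  have hθabs : 0 < |θ₀| := abs_pos.2 hθ0
  have hδ0 : 0 < δ := lt_min (by positivity) (by positivity)
  have hδ1 : δ ≤ |θ₀| / 6 := min_le_left _ _
  have hδ2 : C * ((δ + 3 * δ) / γ) ≤ θ₀ ^ 2 / 16 := by
    have h := min_le_right (|θ₀| / 6) (θ₀ ^ 2 * γ / (64 * (C + 1)))
    rw [← hδ, le_div_iff₀ (by positivity)] at h
    rw [← mul_div_assoc, div_le_iff₀ hγ0]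
    nlinarith
  refine ⟨3 * δ / 2, min (δ ^ 2 / 32) (η ^ 2 / 72), 4 * (2 * S.card + 1), by positivity,
    lt_min (by positivity) (by positivity), by positivity, ?_⟩
  have hcast : Tendsto (fun n : ℕ => (n : ℝ)) atTop atTop := tendsto_natCast_atTop_atTop
  have hlarge : ∀ᶠ n : ℕ in atTop, 4 ≤ δ * n ∧ 6 ≤ η * n ∧
      64 * (1 + C) ^ 2 < θ₀ ^ 4 * (n : ℝ) ^ 2 :=
    ((hcast.const_mul_atTop hδ0).eventually_ge_atTop 4).and
      (((hcast.const_mul_atTop hη0).eventually_ge_atTop 6).and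
        ((((tendsto_pow_atTop two_ne_zero).comp hcast).const_mul_atTop
          (by positivity : 0 < θ₀ ^ 4)).eventually_gt_atTop _))
  obtain ⟨N, hN⟩ := eventually_atTop.1 hlarge
  refine ⟨fun n => deviationEvent n F_in F_out (blockCoefficient F_in F_out p_in p_out) S δ η,
    N, fun n hn => ?_⟩
  obtain ⟨hnδ, hnη, hnC⟩ := hN n hn
  refine ⟨measurableSet_deviationEvent _ S δ η,
    sgbmLaw_deviationEvent_le h_in h_out hδ0 hη0 hp_in hp_out hS_in hS_out hnδ hnη, ?_⟩
  intro σ X G hz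
  simp only [deviationEvent, modeDeviation, squareDeviation, Set.mem_union, Set.mem_iUnion, Set.mem_ofPred_eq, not_or,
    not_exists, not_and, not_le] at hz
  have hideal : idealValue n F_in F_out = n * θ₀ := by rw [idealValue, hθ₀]; ring
  rw [hideal]
  set φ : S × Fin 2 → Fin n → ℂ := fun κ i => blockMode κ.1 κ.2 (X i) (σ i) with hφ
  have hsymm : (adjacencyMatrix G).IsHermitian :=
    Matrix.IsHermitian.ext fun i j => by simp [adjacencyMatrix_comm _ j i]
  have hentry : ∀ i j, |adjacencyMatrix G i j| ≤ 1 := fun i j => by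
    rw [adjacencyMatrix_apply]; split_ifs <;> simp
  have hφ1 : ∀ κ i, ‖φ κ i‖ ≤ 1 := fun κ i => (norm_blockMode _ _ _ _).le
  have hχ : ∀ i, φ κ₀ i = (blockSign 1 (σ i) : ℝ) := fun i => by
    simp [hφ, blockMode, hκ₀, mFourier_zero]
  have hχ1 : ∀ i, blockSign 1 (σ i) ^ 2 = 1 := fun i => by
    rw [← sq_abs, abs_blockSign, one_pow]
  have hθκ₀ : θ κ₀ = θ₀ := by
    simp only [hθ, hκ₀, blockModeValue, torusFourier_zero, hθ₀]
    simp [blockSign, sub_eq_add_neg]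
  have hE : ∀ κ i, ‖∑ j, (adjacencyMatrix G i j : ℂ) * φ κ j - n * θ κ * φ κ i‖ ≤ δ * n :=
    fun κ i => (hz.1 i κ).le
  have hsq : ∀ i j, i ≠ j → ‖((adjacencyMatrix G * adjacencyMatrix G) i j : ℂ) -
      n * ∑ κ, c κ * φ κ i * conj (φ κ j)‖ ≤ η * n := fun i j hij => (hz.2 i j hij).le
  exact exists_isolated_eigenvalue hsymm hentry hφ1 hχ hχ1 hθκ₀ hθ0 hδ0 hγ0 hη0.le le_rfl
    hγ le_rfl (by linarith) le_rfl hδ2 hnC hE hsq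

end SpectralGap

/-! ### Conclusion by the Borel–Cantelli lemma. -/

theorem mainTheorem4 (d : ℕ) (F_in F_out : UnitAddTorus (Fin d) → ℝ)
    (hF_in : IsConnectivityFunction F_in) (hF_out : IsConnectivityFunction F_out)
    (hne : edgeDensity F_in ≠ edgeDensity F_out)
    (hsum : ∀ k : Fin d → ℤ, torusFourier F_in k + torusFourier F_out k ≠
      ((edgeDensity F_in - edgeDensity F_out : ℝ) : ℂ))
    (hdiff : ∀ k : Fin d → ℤ, k ≠ 0 → torusFourier F_in k - torusFourier F_out k ≠
      ((edgeDensity F_in - edgeDensity F_out : ℝ) : ℂ)) :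
    ∃ ε : ℝ, 0 < ε ∧
      ∀ (Ω : Type*) [MeasurableSpace Ω] (P : Measure Ω) [IsProbabilityMeasure P]
        (σ : ∀ m : ℕ, Ω → Fin (2 * m) → Fin 2)
        (X : ∀ m : ℕ, Ω → Fin (2 * m) → UnitAddTorus (Fin d))
        (G : ∀ m : ℕ, Ω → SimpleGraph (Fin (2 * m))),
        (∀ m, HasLaw (fun ω => (σ m ω, X m ω, G m ω)) (sgbmLaw (2 * m) F_in F_out) P) →
        ∀ᵐ ω ∂P, ∀ᶠ m : ℕ in atTop,
          ∃ t : ℝ, IsEigenvalue (adjacencyMatrix (G m ω)) t ∧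
            eigenvalueMultiplicity (adjacencyMatrix (G m ω)) t = 1 ∧
            ∀ s : ℝ, IsEigenvalue (adjacencyMatrix (G m ω)) s → s ≠ t →
              |t - idealValue (2 * m) F_in F_out| < |s - idealValue (2 * m) F_in F_out| ∧
              ε * (2 * m : ℕ) ≤ |s - t| ∧
              ε * (2 * m : ℕ) ≤ |s - idealValue (2 * m) F_in F_out| := by
  obtain ⟨ε, a, C, hε, ha, hC, B, N, hN⟩ :=
    exists_event_isolated_eigenvalue hF_in hF_out hne hsum hdiff
  refine ⟨ε, hε, fun Ω _ P _ σ X G hlaw => ?_⟩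
  -- Including `N ≤ 2 * m` in the event makes the bound valid for every `m`, as the sum over all `m`
  -- requires.
  have hbound : ∀ m, P {ω | N ≤ 2 * m ∧ (σ m ω, X m ω, G m ω) ∈ B (2 * m)} ≤
      ENNReal.ofReal (C * (((2 * m : ℕ) : ℝ) ^ 2 * Real.exp (-a * (2 * m : ℕ)))) := by
    intro m
    by_cases hm : N ≤ 2 * m
    · have h := (hlaw m).measure_eq (p := fun z => z ∈ B (2 * m)) (hN _ hm).1
      simp only [hm, true_and]
      rw [h]
      exact (hN _ hm).2.1
    · simp [hm]
  have hsummable : Summable fun m : ℕ =>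
      C * (((2 * m : ℕ) : ℝ) ^ 2 * Real.exp (-a * (2 * m : ℕ))) :=
    ((Real.summable_pow_mul_exp_neg_nat_mul 2 ha).comp_injective
      (mul_right_injective₀ (two_ne_zero' ℕ))).mul_left C
  -- Convergence of the series is all that the first Borel–Cantelli lemma needs, so the joint
  -- distribution of the graphs is irrelevant.
  have hfin : ∑' m, P {ω | N ≤ 2 * m ∧ (σ m ω, X m ω, G m ω) ∈ B (2 * m)} ≠ ⊤ :=
    ne_top_of_le_ne_top hsummable.tsum_ofReal_ne_top (ENNReal.tsum_le_tsum hbound)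
  filter_upwards [ae_eventually_notMem hfin] with ω hω
  filter_upwards [hω, eventually_ge_atTop N] with m hm hmN
  have hm2 : N ≤ 2 * m := by omega
  exact (hN (2 * m) hm2).2.2 (σ m ω) (X m ω) (G m ω) fun h => hm ⟨hm2, h⟩
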